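/- **Theorem 1 (packet loss rate with partial CSI).** *Caching and requests.* A library has $N$ packets; packet $j$ is requested with probability $f_j\ge 0$, $\sum_j f_j=1$. The users are divided into $\binom NM$ subsets; a fraction $p_i\ge 0$ of the users belongs to subset $i$, $\sum_i p_i=1$, and each user of subset $i$ has cached the $M$ packets $j$ with $q_{i,j}=1$ ($q_{i,j}\in\{0,1\}$, $\sum_j q_{i,j}=M$). The fraction of base stations (BSs) transmitting packet $j$ is $$\alpha_j=\frac{\sum_{k}p_k(1-q_{k,j})f_j}{\sum_{j'}\sum_{k}p_k(1-q_{k,j'})f_{j'}} ,$$ the denominator being positive. *Network.* BSs form a homogeneous Poisson point process of intensity $\lambda_b>0$ in $\mathbb R^2$; a typical user of subset $i$ sits at the origin, is served by its nearest BS, at distance $R$, and requests a packet that it has not cached. Independently of the locations and of each other, each interfering BS transmits packet $j$ with probability $\alpha_j$, and each channel has a Rayleigh fading coefficient $h$ with $\mathbb E|h|^2=1$. With transmit power $P>0$, path-loss exponent $\beta>2$, noise power $\sigma^2\ge0$ and a radius $R_b\ge0$, the received power from a BS at distance $d$ is $P|h|^2d^{-\beta}$. Interfering BSs that transmit a packet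 cached by the user are cancelled if they are within distance $R_b$. Thus $$\mathrm{SINR}=\frac{P|h_{0}|^2R^{-\beta}}{I_c+I_u+\sigma^2},$$ where $I_c$ is the sum of the received powers over the interfering BSs that transmit cached packets and lie at distance at least $\max\{R,R_b\}$, and $I_u$ is the sum over the interfering BSs that transmit packets not cached by the user. With packet length $T>0$, slot duration $\tau>0$ and bandwidth $B>0$, the packet loss rate is $\mathcal P_l=\mathbb P\big[\tau B\log_2(1+\mathrm{SINR})<T\big]$. Put $$\bar T=2^{T/(\tau B)}-1,\qquad \lambda_{b1}=\lambda_b\sum_j\alpha_jq_{i,j},\qquad \lambda_{b2}=\lambda_b-\lambda_{b1},$$ $$\mathcal Z_1(x)=\frac{2\,\bar T^{2/\beta}\,x^{1-2/\beta}}{\beta-2}\;{}_2F_1\Big[1,1-\tfrac2\beta;2-\tfrac2\beta;-x\Big]\qquad(x\ge0),$$ where ${}_2F_1$ is the Gauss hypergeometric function (continued analytically to $(-\infty,1)$). *Claim.* $\mathcal P_l=1-\mathcal P_{s,i}-\mathcal P_{b,i}$, where $\mathcal P_{s,i}=\mathbb P[\mathrm{SINR}\ge\bar T,\ R\le R_b]$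 and $\mathcal P_{b,i}=\mathbb P[\mathrm{SINR}\ge\bar T,\ R>R_b]$ are given by the convergent integrals $$\mathcal P_{s,i}=2\pi\lambda_b\int_0^{R_b} r\exp\Big\{-r^\beta P^{-1}\bar T\sigma^2-\pi r^2\Big(\lambda_{b1}\mathcal Z_1\Big[\Big(\frac r{R_b}\Big)^\beta\bar T\Big]+\lambda_{b2}\mathcal Z_1(\bar T)+\lambda_b\Big)\Big\}\,dr,$$ $$\mathcal P_{b,i}=2\pi\lambda_b\int_{R_b}^\infty r\exp\Big\{-r^\beta P^{-1}\bar T\sigma^2-\pi r^2\lambda_b\big(\mathcal Z_1(\bar T)+1\big)\Big\}\,dr .$$ -/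

import Mathlib

open MeasureTheory ProbabilityTheory

namespace CacheNet

/-! ## The Gauss hypergeometric function at real arguments below one

Mathlib's `₂F₁` is the sum of the hypergeometric series, hence junk outside the unit disc, while
arguments below `-1` are needed here. For `0 < b < c` the function is given on `(-∞, 1)` by
Euler's integral; it is proved below to be the analytic continuation of the series. -/

/-- The Gauss hypergeometric function `₂F₁[a, b; c; x]` for `0 < b < c` and real `x < 1`. -/
noncomputable def gaussHypergeometric (a b c x : ℝ) : ℝ :=
  Real.Gamma c / (Real.Gamma b * Real.Gamma (c - b)) *
    ∫ t in (0 : ℝ)..1, t ^ (b - 1) * (1 - t) ^ (c - b - 1) * (1 - x * t) ^ (-a)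

theorem eulerWeight_spec {u v : ℝ} (hu : 0 < u) (hv : 0 < v) :
    IntervalIntegrable (fun t : ℝ => t ^ (u - 1) * (1 - t) ^ (v - 1)) MeasureTheory.volume 0 1 ∧
      ∫ t in (0 : ℝ)..1, t ^ (u - 1) * (1 - t) ^ (v - 1) =
        Real.Gamma u * Real.Gamma v / Real.Gamma (u + v) := by
  have hc := Complex.betaIntegral_convergent (u := (u : ℂ)) (v := (v : ℂ)) (by simpa) (by simpa)
  have key : Set.EqOn (fun x : ℝ => (x : ℂ) ^ ((u : ℂ) - 1) * (1 - (x : ℂ)) ^ ((v : ℂ) - 1))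
      (fun t : ℝ => ((t ^ (u - 1) * (1 - t) ^ (v - 1) : ℝ) : ℂ)) (Set.uIcc 0 1) := by
    intro t ht
    rw [Set.uIcc_of_le zero_le_one] at ht
    simp only
    rw [Complex.ofReal_mul, Complex.ofReal_cpow ht.1, Complex.ofReal_cpow (by linarith [ht.2])]
    push_cast
    rfl
  have hc' := hc.congr (fun t ht => key (Set.uIoc_subset_uIcc ht))
  constructor
  · have := hc'.norm
    refine this.congr (fun t ht => ?_)
    have ht' := Set.uIoc_subset_uIcc ht
    rw [Set.uIcc_of_le zero_le_one] at ht'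
    have h0 : 0 ≤ t ^ (u - 1) * (1 - t) ^ (v - 1) :=
      mul_nonneg (Real.rpow_nonneg ht'.1 _) (Real.rpow_nonneg (by linarith [ht'.2]) _)
    simp only [Complex.norm_real, Real.norm_eq_abs, abs_of_nonneg h0]
  · have h := ProbabilityTheory.beta_eq_betaIntegralReal u v hu hv
    rw [ProbabilityTheory.beta] at h
    rw [h, Complex.betaIntegral, intervalIntegral.integral_congr key,
      intervalIntegral.integral_ofReal, Complex.ofReal_re]

theorem gamma_add_nat (z : ℝ) (hz : 0 < z) (n : ℕ) :
    Real.Gamma (z + n) = (ascPochhammer ℝ n).eval z * Real.Gamma z := by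
  induction n with
  | zero => simp
  | succ n ih =>
    have : z + ((n + 1 : ℕ) : ℝ) = (z + n) + 1 := by push_cast; ring
    rw [this, Real.Gamma_add_one (by positivity), ih, ascPochhammer_succ_right]
    simp
    ring

open Polynomial in
theorem hasSum_one_sub_rpow (a y : ℝ) (hy : |y| < 1) :
    Summable (fun n : ℕ => |(n.factorial : ℝ)⁻¹ * (ascPochhammer ℝ n).eval a * y ^ n|) ∧
    HasSum (fun n : ℕ => (n.factorial : ℝ)⁻¹ * (ascPochhammer ℝ n).eval a * y ^ n)
      ((1 - y) ^ (-a)) := by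
  have hball : (-y) ∈ Metric.eball (0 : ℝ) 1 := by
    simp only [Metric.mem_eball, edist_zero_right, enorm_neg]
    rw [← ofReal_norm, ENNReal.ofReal_lt_one]
    exact hy
  have hf := Real.one_add_rpow_hasFPowerSeriesOnBall_zero (a := -a)
  have hterm : ∀ n : ℕ, (binomialSeries ℝ (-a) n fun _ => -y) =
      (n.factorial : ℝ)⁻¹ * (ascPochhammer ℝ n).eval a * y ^ n := by
    intro n
    rw [binomialSeries_eq_ordinaryHypergeometricSeries (b := (1 : ℝ)) (by
      intro k hk; have : (0:ℝ) ≤ k := Nat.cast_nonneg k; linarith)]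
    simp only [FormalMultilinearSeries.compContinuousLinearMap_apply, neg_neg]
    have : (⇑(-ContinuousLinearMap.id ℝ ℝ) ∘ fun _ : Fin n => -y) = fun _ => y := by
      ext; simp
    rw [this, ordinaryHypergeometricSeries_apply_eq]
    have h1 : (ascPochhammer ℝ n).eval 1 ≠ 0 := (ascPochhammer_pos n 1 one_pos).ne'
    simp only [smul_eq_mul]
    field_simp
  constructor
  · have := (binomialSeries ℝ (-a)).summable_norm_apply
      (Metric.eball_subset_eball hf.r_le hball)
    refine this.congr fun n => ?_
    rw [hterm, Real.norm_eq_abs]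
  · have := hf.hasSum hball
    simp only [hterm, zero_add] at this
    simpa [sub_eq_add_neg] using this

/-- On the unit disc the function is the Gauss hypergeometric series. -/
theorem gaussHypergeometric_eq_ordinaryHypergeometric {a b c x : ℝ} (hb : 0 < b) (hc : b < c)
    (hx : |x| < 1) : gaussHypergeometric a b c x = ordinaryHypergeometric a b c x := by
  have hcb : 0 < c - b := sub_pos.2 hc
  set k : ℕ → ℝ := fun n => (n.factorial : ℝ)⁻¹ * (ascPochhammer ℝ n).eval a with hk
  have hw := (eulerWeight_spec hb hcb).1
  have hsum : Summable fun n => |k n * x ^ n| := (hasSum_one_sub_rpow a x hx).1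
  have main : HasSum (fun n : ℕ => ∫ t in (0 : ℝ)..1,
        t ^ (b - 1) * (1 - t) ^ (c - b - 1) * (k n * (x * t) ^ n))
      (∫ t in (0 : ℝ)..1, t ^ (b - 1) * (1 - t) ^ (c - b - 1) * (1 - x * t) ^ (-a)) := by
    refine intervalIntegral.hasSum_integral_of_dominated_convergence
      (fun n t => |k n * x ^ n| * (t ^ (b - 1) * (1 - t) ^ (c - b - 1))) ?_ ?_ ?_ ?_ ?_
    · intro n
      exact (by fun_prop : Measurable fun t : ℝ =>
        t ^ (b - 1) * (1 - t) ^ (c - b - 1) * (k n * (x * t) ^ n)).aestronglyMeasurable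
    · intro n
      refine Filter.Eventually.of_forall fun t ht => ?_
      rw [Set.uIoc_of_le zero_le_one] at ht
      have h0 : 0 ≤ t ^ (b - 1) * (1 - t) ^ (c - b - 1) :=
        mul_nonneg (Real.rpow_nonneg ht.1.le _) (Real.rpow_nonneg (by linarith [ht.2]) _)
      rw [norm_mul, Real.norm_of_nonneg h0, mul_comm]
      refine mul_le_mul_of_nonneg_right ?_ h0
      rw [mul_pow, ← mul_assoc, Real.norm_eq_abs, abs_mul _ (t ^ n), abs_of_nonneg (pow_nonneg ht.1.le n)]
      exact mul_le_of_le_one_right (abs_nonneg _) (pow_le_one₀ ht.1.le ht.2)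
    · exact Filter.Eventually.of_forall fun t _ => hsum.mul_right _
    · simp only [tsum_mul_right]
      exact hw.const_mul _
    · refine Filter.Eventually.of_forall fun t ht => ?_
      rw [Set.uIoc_of_le zero_le_one] at ht
      refine HasSum.mul_left _ (hasSum_one_sub_rpow a (x * t) ?_).2
      rw [abs_mul, abs_of_nonneg ht.1.le]
      exact lt_of_le_of_lt (mul_le_of_le_one_right (abs_nonneg _) ht.2) hx
  rw [gaussHypergeometric, ordinaryHypergeometric_eq_tsum, ← main.tsum_eq, ← tsum_mul_left]
  refine tsum_congr fun n => ?_
  have hbn : 0 < b + n := by positivity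
  have hint := (eulerWeight_spec hbn hcb).2
  have hcongr : ∫ t in (0 : ℝ)..1, t ^ (b - 1) * (1 - t) ^ (c - b - 1) * (k n * (x * t) ^ n) =
      k n * x ^ n * ∫ t in (0 : ℝ)..1, t ^ (b + n - 1) * (1 - t) ^ (c - b - 1) := by
    rw [← intervalIntegral.integral_const_mul, intervalIntegral.integral_of_le zero_le_one,
      intervalIntegral.integral_of_le zero_le_one]
    refine MeasureTheory.setIntegral_congr_fun measurableSet_Ioc fun t ht => ?_
    have : t ^ (b + n - 1) = t ^ (b - 1) * t ^ n := by
      rw [← Real.rpow_natCast, ← Real.rpow_add ht.1]; ring_nf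
    simp only [this, mul_pow]
    ring
  rw [hcongr, hint, gamma_add_nat b hb, show b + n + (c - b) = c + n by ring,
    gamma_add_nat c (hb.trans hc)]
  have := (Real.Gamma_pos_of_pos hb).ne'
  have := (Real.Gamma_pos_of_pos hcb).ne'
  have := (Real.Gamma_pos_of_pos (hb.trans hc)).ne'
  have := (ascPochhammer_pos n c (hb.trans hc)).ne'
  simp only [hk, smul_eq_mul]
  field_simp

/-- Together with the previous fact, this says that `gaussHypergeometric a b c` is the analytic
continuation of the series to `(-∞, 1)`. -/
theorem gaussHypergeometric_analyticOnNhd {a b c : ℝ} (hb : 0 < b) (hc : b < c) :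
    AnalyticOnNhd ℝ (gaussHypergeometric a b c) (Set.Iio 1) := by
  have hcb : 0 < c - b := sub_pos.2 hc
  set w : ℝ → ℝ := fun t => t ^ (b - 1) * (1 - t) ^ (c - b - 1) with hwdef
  have hw : IntervalIntegrable w MeasureTheory.volume 0 1 := (eulerWeight_spec hb hcb).1
  have hwm : Measurable w := by fun_prop
  set G : ℂ → ℂ := fun z => ∫ t in (0 : ℝ)..1, (w t : ℂ) * (1 - z * t) ^ (-(a : ℂ)) with hG
  have hslit : ∀ z : ℂ, z.re < 1 → ∀ t ∈ Set.Icc (0 : ℝ) 1, 1 - z * t ∈ Complex.slitPlane := by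
    intro z hz t ht
    left
    simp only [Complex.sub_re, Complex.one_re, Complex.mul_re, Complex.ofReal_re,
      Complex.ofReal_im, mul_zero, sub_zero]
    rcases ht.1.eq_or_lt with h | h
    · rw [← h]; norm_num
    · have := mul_lt_mul_of_pos_right hz h
      linarith [ht.2]
  have hopen : IsOpen {z : ℂ | z.re < 1} := isOpen_lt Complex.continuous_re continuous_const
  have hmeas : ∀ (z : ℂ) (e : ℂ), Measurable fun t : ℝ => (1 - z * (t : ℂ)) ^ e := by
    intro z e
    fun_prop
  have hdiff : DifferentiableOn ℂ G {z : ℂ | z.re < 1} := by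
    intro z₀ hz₀
    obtain ⟨ε, hε, hsub⟩ := Metric.nhds_basis_closedBall.mem_iff.1 (hopen.mem_nhds hz₀)
    have hcont : ∀ e : ℂ, ContinuousOn (fun q : ℂ × ℝ => (1 - q.1 * (q.2 : ℂ)) ^ e)
        (Metric.closedBall z₀ ε ×ˢ Set.Icc (0 : ℝ) 1) := by
      intro e
      refine ContinuousOn.cpow (by fun_prop) continuousOn_const fun q hq => ?_
      exact hslit q.1 (hsub hq.1) q.2 hq.2
    have hcpt : IsCompact (Metric.closedBall z₀ ε ×ˢ Set.Icc (0 : ℝ) 1) :=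
      (isCompact_closedBall z₀ ε).prod isCompact_Icc
    obtain ⟨C₀, hC₀⟩ := hcpt.exists_bound_of_continuousOn (hcont (-(a : ℂ)))
    obtain ⟨C₁, hC₁⟩ := hcpt.exists_bound_of_continuousOn (hcont (-(a : ℂ) - 1))
    have hz0 : z₀ ∈ Metric.closedBall z₀ ε := Metric.mem_closedBall_self hε.le
    have hIoc : ∀ t ∈ Set.uIoc (0 : ℝ) 1, t ∈ Set.Icc (0 : ℝ) 1 := by
      intro t ht
      rw [Set.uIoc_of_le zero_le_one] at ht
      exact ⟨ht.1.le, ht.2⟩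
    have := (intervalIntegral.hasDerivAt_integral_of_dominated_loc_of_deriv_le
      (μ := MeasureTheory.volume) (a := 0) (b := 1)
      (F := fun (z : ℂ) (t : ℝ) => (w t : ℂ) * (1 - z * t) ^ (-(a : ℂ)))
      (F' := fun (z : ℂ) (t : ℝ) =>
        (w t : ℂ) * (-(a : ℂ) * (1 - z * t) ^ (-(a : ℂ) - 1) * (-(t : ℂ))))
      (x₀ := z₀) (s := Metric.closedBall z₀ ε) (bound := fun t => |w t| * (|a| * C₁))
      (Metric.closedBall_mem_nhds z₀ hε) ?_ ?_ ?_ ?_ ?_ ?_).2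
    · exact this.differentiableAt.differentiableWithinAt
    · refine Filter.Eventually.of_forall fun z => ?_
      exact ((Complex.measurable_ofReal.comp hwm).mul (hmeas z _)).aestronglyMeasurable
    · refine (hw.norm.mul_const C₀).mono_fun
        ((Complex.measurable_ofReal.comp hwm).mul (hmeas z₀ _)).aestronglyMeasurable ?_
      refine (MeasureTheory.ae_restrict_iff' measurableSet_uIoc).2
        (Filter.Eventually.of_forall fun t ht => ?_)
      have hb := hC₀ (z₀, t) ⟨hz0, hIoc t ht⟩
      simp only [norm_mul, norm_norm, Complex.norm_real]
      exact mul_le_mul_of_nonneg_left (hb.trans (le_abs_self _)) (norm_nonneg _)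
    · exact ((Complex.measurable_ofReal.comp hwm).mul ((measurable_const.mul (hmeas z₀ _)).mul
        (Complex.measurable_ofReal.neg))).aestronglyMeasurable
    · refine Filter.Eventually.of_forall fun t ht z hz => ?_
      have hb := hC₁ (z, t) ⟨hz, hIoc t ht⟩
      have ht' := hIoc t ht
      simp only [norm_mul, norm_neg, Complex.norm_real, Real.norm_eq_abs]
      refine mul_le_mul_of_nonneg_left ?_ (abs_nonneg _)
      rw [abs_of_nonneg ht'.1, mul_assoc]
      refine mul_le_mul_of_nonneg_left ?_ (abs_nonneg _)
      exact (mul_le_of_le_one_right (norm_nonneg _) ht'.2).trans hb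
    · exact hw.norm.mul_const _
    · refine Filter.Eventually.of_forall fun t ht z hz => ?_
      have h1 : HasDerivAt (fun z : ℂ => 1 - z * (t : ℂ)) (-(t : ℂ)) z := by
        simpa using ((hasDerivAt_id z).mul_const (t : ℂ)).const_sub 1
      exact (h1.cpow_const (hslit z (hsub hz) t (hIoc t ht))).const_mul _
  have hGan : AnalyticOnNhd ℂ G {z : ℂ | z.re < 1} := hdiff.analyticOnNhd hopen
  intro x hx
  have h1 : AnalyticAt ℝ (fun y : ℝ => (G (y : ℂ)).re) x :=
    (hGan (x : ℂ) (by simpa using hx)).re_ofReal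
  have h2 : gaussHypergeometric a b c =ᶠ[nhds x] fun y : ℝ =>
      Real.Gamma c / (Real.Gamma b * Real.Gamma (c - b)) * (G (y : ℂ)).re := by
    filter_upwards [isOpen_Iio.mem_nhds hx] with y hy
    have : G (y : ℂ) = ((∫ t in (0 : ℝ)..1, w t * (1 - y * t) ^ (-a) : ℝ) : ℂ) := by
      rw [hG, ← intervalIntegral.integral_ofReal]
      refine intervalIntegral.integral_congr fun t ht => ?_
      rw [Set.uIcc_of_le zero_le_one] at ht
      have hy' : y < 1 := hy
      have h0 : 0 ≤ 1 - y * t := by nlinarith [ht.1, ht.2]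
      rw [Complex.ofReal_mul (w t), Complex.ofReal_cpow h0]
      push_cast
      rfl
    rw [this, Complex.ofReal_re, gaussHypergeometric]
  exact (analyticAt_const.mul h1).congr h2.symm

/-! ## Point process and fading -/

/-- The number of points of the sequence `X` that lie in `A`, counted with multiplicity. -/
noncomputable def pointCount {Ω E : Type*} (X : ℕ → Ω → E) (A : Set E) (ω : Ω) : ℕ∞ :=
  {n | X n ω ∈ A}.encard

/-- The random points `X 0, X 1, …` form a Poisson point process with intensity measure `Λ`:
the number of points in a set `A` of finite intensity is Poisson with mean `Λ A`, and the numbers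
of points in finitely many pairwise disjoint such sets are independent. (The points are enumerated
by `ℕ`, which is the case of a process of infinite total intensity.) -/
structure IsPoissonPointProcess {Ω E : Type*} [MeasurableSpace Ω] [MeasurableSpace E]
    (X : ℕ → Ω → E) (Λ : Measure E) (μ : Measure Ω) : Prop where
  measurable : ∀ n, Measurable (X n)
  count_law : ∀ A : Set E, MeasurableSet A → Λ A ≠ ⊤ → ∀ k : ℕ,
    μ {ω | pointCount X A ω = (k : ℕ∞)} = poissonMeasure (Λ A).toNNReal {k}
  count_indep : ∀ (m : ℕ) (A : Fin m → Set E), (∀ j, MeasurableSet (A j)) →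
    (∀ j, Λ (A j) ≠ ⊤) → Pairwise (fun j j' => Disjoint (A j) (A j')) →
    iIndepFun (fun j => pointCount X (A j)) μ

/-- The Rayleigh distribution with mean square (average power) `w`. -/
noncomputable def rayleighMeasure (w : ℝ) : Measure ℝ :=
  volume.withDensity fun x =>
    ENNReal.ofReal (if 0 ≤ x then 2 * x / w * Real.exp (-x ^ 2 / w) else 0)

/-! ## Requests and caches -/

/-- A library of `N` packets with access probabilities `f`; the users fall into `N.choose M`
subsets, a fraction `p i` of the users belonging to the `i`-th one, and every user of the `i`-th
subset has cached the `M` packets in `cache i`. -/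
structure CachingScheme (N M : ℕ) where
  f : Fin N → ℝ
  f_nonneg : ∀ j, 0 ≤ f j
  f_sum : ∑ j, f j = 1
  p : Fin (N.choose M) → ℝ
  p_nonneg : ∀ i, 0 ≤ p i
  p_sum : ∑ i, p i = 1
  cache : Fin (N.choose M) → Finset (Fin N)
  cache_card : ∀ i, (cache i).card = M

namespace CachingScheme

variable {N M : ℕ}

/-- `q i j = 1` if the users of the `i`-th subset have cached packet `j`, else `q i j = 0`. -/
def q (C : CachingScheme N M) (i : Fin (N.choose M)) (j : Fin N) : ℝ :=
  if j ∈ C.cache i then 1 else 0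

/-- The fraction of base stations that transmit packet `j` in a slot. -/
noncomputable def alpha (C : CachingScheme N M) (j : Fin N) : ℝ :=
  (∑ i, C.p i * (1 - C.q i j) * C.f j) / ∑ j', ∑ i, C.p i * (1 - C.q i j') * C.f j'

end CachingScheme

/-! ## The downlink -/

/-- The parameters of the radio system. -/
structure RadioSystem where
  /-- density of the base stations -/
  lam : ℝ
  lam_pos : 0 < lam
  /-- transmit power -/
  P : ℝ
  P_pos : 0 < P
  /-- path-loss exponent -/
  β : ℝ
  two_lt_β : 2 < β
  /-- noise power `σ²` -/
  noise : ℝ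
  noise_nonneg : 0 ≤ noise
  /-- bandwidth -/
  B : ℝ
  B_pos : 0 < B
  /-- slot duration -/
  τ : ℝ
  τ_pos : 0 < τ
  /-- packet length -/
  T : ℝ
  T_pos : 0 < T
  /-- distance below which the channel from a base station is known to the user -/
  Rb : ℝ
  Rb_nonneg : 0 ≤ Rb

/-- The Euclidean plane. -/
abbrev Plane : Type := EuclideanSpace ℝ (Fin 2)

namespace RadioSystem

/-- The SINR threshold `2 ^ (T / (τ B)) - 1`. -/
noncomputable def Tbar (S : RadioSystem) : ℝ := (2 : ℝ) ^ (S.T / (S.τ * S.B)) - 1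

/-- Density of the base stations that transmit a packet cached by the `i`-th subset. -/
noncomputable def lam1 (S : RadioSystem) {N M : ℕ} (C : CachingScheme N M)
    (i : Fin (N.choose M)) : ℝ :=
  S.lam * ∑ j, C.alpha j * C.q i j

/-- Density of the base stations that transmit a packet not cached by the `i`-th subset. -/
noncomputable def lam2 (S : RadioSystem) {N M : ℕ} (C : CachingScheme N M)
    (i : Fin (N.choose M)) : ℝ :=
  S.lam * (1 - ∑ j, C.alpha j * C.q i j)

/-- `Z₁(x) = (2 T̄^(2/β) x^(1-2/β) / (β-2)) ₂F₁[1, 1-2/β; 2-2/β; -x]`. -/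
noncomputable def Z1 (S : RadioSystem) (x : ℝ) : ℝ :=
  2 * S.Tbar ^ (2 / S.β) * x ^ (1 - 2 / S.β) / (S.β - 2) *
    gaussHypergeometric 1 (1 - 2 / S.β) (2 - 2 / S.β) (-x)

end RadioSystem

section Downlink

variable {Ω : Type*}

/-- The base stations, seen from a typical user at the origin: `X n` is the location of the `n`-th
base station, `K n` the packet that it transmits when it is an interferer, and `H n` the fading
coefficient of its channel to the user. The locations form a homogeneous Poisson point process;
given the locations, all packets and all fading coefficients are independent, the packets with
distribution `alpha`, the fading of Rayleigh type with unit average power. -/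
structure IsDownlinkModel [MeasurableSpace Ω] {N M : ℕ} (C : CachingScheme N M) (S : RadioSystem)
    (μ : Measure Ω) (X : ℕ → Ω → Plane) (K : ℕ → Ω → Fin N) (H : ℕ → Ω → ℂ) : Prop where
  poisson : IsPoissonPointProcess X (ENNReal.ofReal S.lam • volume) μ
  measurable_packet : ∀ n, Measurable (K n)
  measurable_fading : ∀ n, Measurable (H n)
  packet_law : ∀ n j, μ.real {ω | K n ω = j} = C.alpha j
  fading_law : ∀ n, μ.map (fun ω => ‖H n ω‖) = rayleighMeasure 1
  packet_indep_fading : ∀ n, IndepFun (K n) (H n) μ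
  marks_indep : iIndepFun (fun n ω => (K n ω, H n ω)) μ
  location_indep_marks : IndepFun (fun ω n => X n ω) (fun ω n => (K n ω, H n ω)) μ

/-- The serving base station is the nearest one (a nearest one exists almost surely and is almost
surely unique; ties are resolved in favour of the smallest index). -/
noncomputable def servingIndex (X : ℕ → Ω → Plane) (ω : Ω) : ℕ :=
  sInf {n | ∀ m, ‖X n ω‖ ≤ ‖X m ω‖}

/-- The distance `R` from the user to its serving base station. -/
noncomputable def servingDist (X : ℕ → Ω → Plane) (ω : Ω) : ℝ := ‖X (servingIndex X ω) ω‖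

/-- The power received from the `n`-th base station. -/
noncomputable def rxPower (S : RadioSystem) (X : ℕ → Ω → Plane) (H : ℕ → Ω → ℂ) (n : ℕ)
    (ω : Ω) : ℝ :=
  S.P * ‖H n ω‖ ^ 2 * ‖X n ω‖ ^ (-S.β)

variable {N M : ℕ}

open Classical in
/-- Residual interference of the interfering base stations that transmit cached packets: those
within distance `Rb` are cancelled. -/
noncomputable def cachedInterference (C : CachingScheme N M) (S : RadioSystem)
    (X : ℕ → Ω → Plane) (K : ℕ → Ω → Fin N) (H : ℕ → Ω → ℂ) (i : Fin (N.choose M)) (ω : Ω) : ℝ :=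
  ∑' n, if n ≠ servingIndex X ω ∧ K n ω ∈ C.cache i ∧ max (servingDist X ω) S.Rb ≤ ‖X n ω‖
    then rxPower S X H n ω else 0

open Classical in
/-- Interference of the interfering base stations that transmit packets which are not cached. -/
noncomputable def uncachedInterference (C : CachingScheme N M) (S : RadioSystem)
    (X : ℕ → Ω → Plane) (K : ℕ → Ω → Fin N) (H : ℕ → Ω → ℂ) (i : Fin (N.choose M)) (ω : Ω) : ℝ :=
  ∑' n, if n ≠ servingIndex X ω ∧ K n ω ∉ C.cache i ∧ servingDist X ω ≤ ‖X n ω‖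
    then rxPower S X H n ω else 0

/-- Signal-to-interference-plus-noise ratio of the typical user in the `i`-th subset. -/
noncomputable def sinr (C : CachingScheme N M) (S : RadioSystem)
    (X : ℕ → Ω → Plane) (K : ℕ → Ω → Fin N) (H : ℕ → Ω → ℂ) (i : Fin (N.choose M)) (ω : Ω) : ℝ :=
  rxPower S X H (servingIndex X ω) ω /
    (cachedInterference C S X K H i ω + uncachedInterference C S X K H i ω + S.noise)

/-- The rate of loss of packet `l`, for users in the `i`-th subset: a cached packet is read locally,
any other packet is lost if it cannot be transmitted completely within the slot. -/
noncomputable def packetLossRate [MeasurableSpace Ω] (μ : Measure Ω) (C : CachingScheme N M)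
    (S : RadioSystem) (X : ℕ → Ω → Plane) (K : ℕ → Ω → Fin N) (H : ℕ → Ω → ℂ)
    (i : Fin (N.choose M)) (l : Fin N) : ℝ :=
  μ.real {ω | l ∉ C.cache i ∧ S.τ * S.B * Real.logb 2 (1 + sinr C S X K H i ω) < S.T}

/-- Probability of a success with the serving base station within distance `Rb`. -/
noncomputable def nearSuccess [MeasurableSpace Ω] (μ : Measure Ω) (C : CachingScheme N M)
    (S : RadioSystem) (X : ℕ → Ω → Plane) (K : ℕ → Ω → Fin N) (H : ℕ → Ω → ℂ)
    (i : Fin (N.choose M)) : ℝ :=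
  μ.real {ω | S.Tbar ≤ sinr C S X K H i ω ∧ servingDist X ω ≤ S.Rb}

/-- Probability of a success with the serving base station beyond distance `Rb`. -/
noncomputable def farSuccess [MeasurableSpace Ω] (μ : Measure Ω) (C : CachingScheme N M)
    (S : RadioSystem) (X : ℕ → Ω → Plane) (K : ℕ → Ω → Fin N) (H : ℕ → Ω → ℂ)
    (i : Fin (N.choose M)) : ℝ :=
  μ.real {ω | S.Tbar ≤ sinr C S X K H i ω ∧ S.Rb < servingDist X ω}

end Downlink

/-- The integrand, in the serving distance `r ≤ Rb`, of the probability of a near success. -/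
noncomputable def nearIntegrand {N M : ℕ} (C : CachingScheme N M) (S : RadioSystem)
    (i : Fin (N.choose M)) (r : ℝ) : ℝ :=
  r * Real.exp (-(r ^ S.β * S.P⁻¹ * S.Tbar * S.noise) -
    Real.pi * r ^ 2 * (S.lam1 C i * S.Z1 ((r / S.Rb) ^ S.β * S.Tbar) +
      S.lam2 C i * S.Z1 S.Tbar + S.lam))

/-- The integrand, in the serving distance `r > Rb`, of the probability of a far success. -/
noncomputable def farIntegrand (S : RadioSystem) (r : ℝ) : ℝ :=
  r * Real.exp (-(r ^ S.β * S.P⁻¹ * S.Tbar * S.noise) -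
    Real.pi * r ^ 2 * S.lam * (S.Z1 S.Tbar + 1))

end CacheNet

/-!
The proof rests on the generating functional of a Poisson point process,
`𝔼 ∏ₙ v (X n) = exp (-∫ (1 - v) dΛ)` (`IsPoissonPointProcess.integral_infProd`), which is obtained
for step functions from the independent Poisson counts and extended by approximation.

Almost surely the interference converges and is positive (Campbell's formula and `β > 2`), so that a
success is an event about partial sums (`Tbar_le_sinr_iff`). Given the locations, the serving signal
is an exponential variable independent of the interference; hence the success probability is a
Laplace transform, and it factorizes over the interferers into
`exp (-relNoise) * ∏ survival` (`measureReal_forall_partial_sum_le`, `measureReal_success_Ioc`).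

That product involves the serving distance `R` and leaves the serving base station out. Instead of
conditioning on the nearest point, the probability of a success with `R ∈ (s, t]` is bounded from
both sides by generating functionals of functions that vanish up to distance `s`, are constant in
the shell between `s` and `t`, and equal a survival factor with a frozen serving distance beyond
(`shell`). The upper bound `measureReal_success_Ioc_le` ignores the interferers in the shell. The
lower bound `le_measureReal_success_Ioc` needs exactly one point in the shell; with `k` points there
the combination `(θ ^ k - 0 ^ k) / θ - θ` is at most the indicator of `k = 1`, and `θ → 0` is
harmless. In polar coordinates the integrals in the exponents become Euler's integral for `Z₁`
(`integral_damping`). Both bounds are `t - s` times the same density to first order, so the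
probability of a success with `R ≤ t` has `2 π λ_b` times the asserted integrand as its right
derivative, and the two formulas follow from the fundamental theorem of calculus.
-/

namespace CacheNet

open Filter Topology
open scoped ENNReal NNReal

/-! ### Infinite products of numbers in the unit interval -/

/-- The infinite product `∏ₙ a n` of numbers in `[0, 1]`, as the infimum of the partial products:
it exists even where it vanishes, and is measurable in the factors. -/
noncomputable def infProd (a : ℕ → ℝ) : ℝ := ⨅ k, ∏ n ∈ Finset.range k, a n

section InfProd

variable {a b : ℕ → ℝ}

theorem antitone_prod_range (h0 : ∀ n, 0 ≤ a n) (h1 : ∀ n, a n ≤ 1) :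
    Antitone fun k => ∏ n ∈ Finset.range k, a n := by
  refine antitone_nat_of_succ_le fun k => ?_
  rw [Finset.prod_range_succ]
  exact mul_le_of_le_one_right (Finset.prod_nonneg fun n _ => h0 n) (h1 k)

theorem bddBelow_prod_range (h0 : ∀ n, 0 ≤ a n) :
    BddBelow (Set.range fun k => ∏ n ∈ Finset.range k, a n) := by
  refine ⟨0, ?_⟩
  rintro _ ⟨k, rfl⟩
  exact Finset.prod_nonneg fun n _ => h0 n

theorem tendsto_infProd (h0 : ∀ n, 0 ≤ a n) (h1 : ∀ n, a n ≤ 1) :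
    Tendsto (fun k => ∏ n ∈ Finset.range k, a n) atTop (𝓝 (infProd a)) :=
  tendsto_atTop_ciInf (antitone_prod_range h0 h1) (bddBelow_prod_range h0)

theorem infProd_le (h0 : ∀ n, 0 ≤ a n) (k : ℕ) : infProd a ≤ ∏ n ∈ Finset.range k, a n :=
  ciInf_le (bddBelow_prod_range h0) k

theorem infProd_nonneg (h0 : ∀ n, 0 ≤ a n) : 0 ≤ infProd a :=
  le_ciInf fun _ => Finset.prod_nonneg fun n _ => h0 n

theorem infProd_le_one (h0 : ∀ n, 0 ≤ a n) : infProd a ≤ 1 := by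
  simpa using infProd_le h0 0

theorem infProd_mono (h0 : ∀ n, 0 ≤ a n) (h : ∀ n, a n ≤ b n) : infProd a ≤ infProd b :=
  le_ciInf fun k => (infProd_le h0 k).trans (Finset.prod_le_prod (fun n _ => h0 n) fun n _ => h n)

/-- Domination of the factors, with a constant `c` to spare in the `n`-th one, carries over to the
products. -/
theorem infProd_le_mul {c : ℝ} (hc : 0 ≤ c) (n : ℕ) (h0 : ∀ m, 0 ≤ a m) (h1 : ∀ m, b m ≤ 1)
    (hb : ∀ m, 0 ≤ b m) (hn : a n ≤ c * b n) (h : ∀ m, m ≠ n → a m ≤ b m) :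
    infProd a ≤ c * infProd b := by
  refine ge_of_tendsto ((tendsto_infProd hb h1).const_mul c) ?_
  filter_upwards [eventually_gt_atTop n] with k hk
  refine (infProd_le h0 k).trans ?_
  have hmem : n ∈ Finset.range k := Finset.mem_range.2 hk
  rw [← Finset.mul_prod_erase _ a hmem, ← Finset.mul_prod_erase _ b hmem, ← mul_assoc]
  refine mul_le_mul hn (Finset.prod_le_prod (fun m _ => h0 m) fun m hm => ?_)
    (Finset.prod_nonneg fun m _ => h0 m) (mul_nonneg hc (hb n))
  exact h m (Finset.ne_of_mem_erase hm)

theorem infProd_le_factor (h0 : ∀ m, 0 ≤ a m) (h1 : ∀ m, a m ≤ 1) (n : ℕ) : infProd a ≤ a n := by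
  have := infProd_le_mul (b := fun _ => 1) (h0 n) n h0 (fun _ => le_rfl) (fun _ => zero_le_one)
    (by simp) (fun m _ => h1 m)
  exact this.trans (mul_le_of_le_one_right (h0 n) (infProd_le_one fun _ => zero_le_one))

theorem measurable_infProd {α : Type*} [MeasurableSpace α] {f : ℕ → α → ℝ}
    (hf : ∀ n, Measurable (f n)) : Measurable fun x => infProd fun n => f n x :=
  Measurable.iInf fun _ => Finset.measurable_fun_prod _ fun n _ => hf n

end InfProd

/-! ### Counts of a Poisson point process -/

section Poisson

variable {Ω E : Type*} [MeasurableSpace Ω] [MeasurableSpace E] {X : ℕ → Ω → E} {Λ : Measure E}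
  {μ : Measure Ω}

theorem measurable_pointCount (hX : ∀ n, Measurable (X n)) {A : Set E} (hA : MeasurableSet A) :
    Measurable (pointCount X A) := by
  refine measurable_encard.comp (measurable_set_iff.2 fun n => ?_)
  exact measurable_to_prop (by simpa [Set.preimage] using hX n hA)

namespace IsPoissonPointProcess

variable [IsProbabilityMeasure μ]

theorem pointCount_ne_top (h : IsPoissonPointProcess X Λ μ) {A : Set E} (hA : MeasurableSet A)
    (hΛ : Λ A ≠ ⊤) : ∀ᵐ ω ∂μ, pointCount X A ω ≠ ⊤ := by
  have hm := measurable_pointCount h.measurable hA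
  have hmeas : ∀ k : ℕ, MeasurableSet {ω | pointCount X A ω = (k : ℕ∞)} := fun k =>
    hm (MeasurableSet.singleton _)
  have hunion : {ω | pointCount X A ω ≠ ⊤} = ⋃ k : ℕ, {ω | pointCount X A ω = (k : ℕ∞)} := by
    ext ω
    simp only [Set.mem_ofPred_eq, Set.mem_iUnion, ENat.ne_top_iff_exists, eq_comm]
  have hdisj : Pairwise fun i j : ℕ => Disjoint {ω | pointCount X A ω = (i : ℕ∞)}
      {ω | pointCount X A ω = (j : ℕ∞)} := by
    intro i j hij
    refine Set.disjoint_left.2 fun ω hi hj => hij ?_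
    exact_mod_cast (hi.symm.trans hj : (i : ℕ∞) = j)
  have hone : μ {ω | pointCount X A ω ≠ ⊤} = 1 := by
    rw [hunion, measure_iUnion hdisj hmeas]
    simp_rw [h.count_law A hA hΛ]
    rw [← measure_iUnion (fun i j hij => by simpa using hij) fun k => MeasurableSet.singleton k,
      Set.iUnion_of_singleton, measure_univ]
  exact (prob_compl_eq_zero_iff (hm (MeasurableSet.singleton (⊤ : ℕ∞)).compl)).2 hone

theorem map_pointCount (h : IsPoissonPointProcess X Λ μ) {A : Set E} (hA : MeasurableSet A)
    (hΛ : Λ A ≠ ⊤) :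
    μ.map (fun ω => (pointCount X A ω).toNat) = poissonMeasure (Λ A).toNNReal := by
  have hm : Measurable fun ω => (pointCount X A ω).toNat :=
    Measurable.of_discrete.comp (measurable_pointCount h.measurable hA)
  refine Measure.ext_of_singleton fun k => ?_
  rw [Measure.map_apply hm (MeasurableSet.singleton k), ← h.count_law A hA hΛ k]
  refine measure_congr ?_
  filter_upwards [h.pointCount_ne_top hA hΛ] with ω hω
  refine propext ?_
  lift pointCount X A ω to ℕ using hω with m hm
  change (pointCount X A ω).toNat = k ↔ pointCount X A ω = (k : ℕ∞)
  rw [← hm]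
  simp

/-- The generating function of a Poisson variable. -/
theorem integral_pow_poissonMeasure (r : ℝ≥0) (θ : ℝ) :
    ∫ n, θ ^ n ∂poissonMeasure r = Real.exp (-((1 - θ) * r)) := by
  rw [integral_poissonMeasure]
  have h := (NormedSpace.expSeries_div_hasSum_exp ((r : ℝ) * θ)).mul_left (Real.exp (-r))
  rw [← Real.exp_eq_exp_ℝ, ← Real.exp_add] at h
  rw [show -((1 - θ) * (r : ℝ)) = -r + r * θ by ring, ← h.tsum_eq]
  refine tsum_congr fun n => ?_
  rw [mul_pow, smul_eq_mul]
  ring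

theorem integral_pow_pointCount (h : IsPoissonPointProcess X Λ μ) {A : Set E}
    (hA : MeasurableSet A) (hΛ : Λ A ≠ ⊤) (θ : ℝ) :
    ∫ ω, θ ^ (pointCount X A ω).toNat ∂μ = Real.exp (-((1 - θ) * Λ.real A)) := by
  have hm : Measurable fun ω => (pointCount X A ω).toNat :=
    Measurable.of_discrete.comp (measurable_pointCount h.measurable hA)
  have := integral_map (μ := μ) hm.aemeasurable (f := fun n : ℕ => θ ^ n)
    Measurable.of_discrete.aestronglyMeasurable
  rw [← this, h.map_pointCount hA hΛ, integral_pow_poissonMeasure]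
  rfl

theorem lintegral_natCast_poissonMeasure (r : ℝ≥0) : ∫⁻ n, (n : ℝ≥0∞) ∂poissonMeasure r = r := by
  rw [lintegral_countable', tsum_eq_zero_add' ENNReal.summable]
  have hstep : ∀ n : ℕ, ((n + 1 : ℕ) : ℝ≥0∞) * poissonMeasure r {n + 1} =
      r * poissonMeasure r {n} := by
    intro n
    rw [poissonMeasure_singleton, poissonMeasure_singleton, ← ENNReal.ofReal_natCast,
      ← ENNReal.ofReal_coe_nnreal, ← ENNReal.ofReal_mul (by positivity),
      ← ENNReal.ofReal_mul (by positivity)]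
    congr 1
    rw [Nat.factorial_succ]
    push_cast
    field_simp
    ring
  simp_rw [hstep]
  rw [ENNReal.tsum_mul_left,
    ← measure_iUnion (fun i j hij => by simpa using hij) fun k => MeasurableSet.singleton k,
    Set.iUnion_of_singleton, measure_univ]
  simp

theorem sum_map_apply (h : IsPoissonPointProcess X Λ μ) {A : Set E} (hA : MeasurableSet A)
    (hΛ : Λ A ≠ ⊤) : Measure.sum (fun n => μ.map (X n)) A = Λ A := by
  have hm : Measurable fun ω => (pointCount X A ω).toNat :=
    Measurable.of_discrete.comp (measurable_pointCount h.measurable hA)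
  have h1 : ∀ ω, ∑' n, (X n ⁻¹' A).indicator (fun _ => (1 : ℝ≥0∞)) ω
      = (pointCount X A ω : ℝ≥0∞) := by
    intro ω
    rw [pointCount, ← ENNReal.tsum_set_one, tsum_subtype {n | X n ω ∈ A} (fun _ => (1 : ℝ≥0∞))]
    rfl
  rw [Measure.sum_apply _ hA]
  calc ∑' n, μ.map (X n) A
      = ∑' n, ∫⁻ ω, (X n ⁻¹' A).indicator (fun _ => (1 : ℝ≥0∞)) ω ∂μ := by
        refine tsum_congr fun n => ?_
        rw [Measure.map_apply (h.measurable n) hA, lintegral_indicator_const (h.measurable n hA),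
          one_mul]
    _ = ∫⁻ ω, (pointCount X A ω : ℝ≥0∞) ∂μ := by
        rw [← lintegral_tsum fun n =>
          (measurable_const.indicator (h.measurable n hA)).aemeasurable]
        simp_rw [h1]
    _ = ∫⁻ ω, (((pointCount X A ω).toNat : ℕ) : ℝ≥0∞) ∂μ := by
        refine lintegral_congr_ae ?_
        filter_upwards [h.pointCount_ne_top hA hΛ] with ω hω
        rw [← ENat.natCast_toNat hω]
        simp
    _ = ∫⁻ n, (n : ℝ≥0∞) ∂μ.map (fun ω => (pointCount X A ω).toNat) :=
        (lintegral_map Measurable.of_discrete hm).symm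
    _ = Λ A := by
        rw [h.map_pointCount hA hΛ, lintegral_natCast_poissonMeasure, ENNReal.coe_toNNReal hΛ]

/-- Campbell's formula, in the form of an equality of measures: the mean number of points is given
by the intensity. -/
theorem sum_map_eq [SigmaFinite Λ] (h : IsPoissonPointProcess X Λ μ) :
    Measure.sum (fun n => μ.map (X n)) = Λ := by
  have hsp := fun k => (measure_spanningSets_lt_top Λ k).ne
  refine Measure.ext fun A hA => ?_
  have hmono : Monotone fun k => A ∩ spanningSets Λ k := fun i j hij =>
    Set.inter_subset_inter_right A (monotone_spanningSets Λ hij)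
  have hU : A = ⋃ k, A ∩ spanningSets Λ k := by
    rw [← Set.inter_iUnion, iUnion_spanningSets, Set.inter_univ]
  rw [hU, hmono.measure_iUnion, hmono.measure_iUnion]
  refine iSup_congr fun k => h.sum_map_apply (hA.inter (measurableSet_spanningSets Λ k)) ?_
  exact measure_ne_top_of_subset Set.inter_subset_right (hsp k)

/-- Almost surely a set of finite intensity contains finitely many points. -/
theorem finite_points (h : IsPoissonPointProcess X Λ μ) {A : Set E} (hA : MeasurableSet A)
    (hΛ : Λ A ≠ ⊤) : ∀ᵐ ω ∂μ, {n | X n ω ∈ A}.Finite := by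
  filter_upwards [h.pointCount_ne_top hA hΛ] with ω hω
  exact Set.encard_ne_top_iff.1 hω

/-- The generating functional of a Poisson process at a step function. -/
theorem integral_infProd_step (h : IsPoissonPointProcess X Λ μ) {m : ℕ} {A : Fin m → Set E}
    (hA : ∀ j, MeasurableSet (A j)) (hΛ : ∀ j, Λ (A j) ≠ ⊤)
    (hdisj : Pairwise fun j j' => Disjoint (A j) (A j')) {θ : Fin m → ℝ} (h0 : ∀ j, 0 ≤ θ j)
    (h1 : ∀ j, θ j ≤ 1) {v : E → ℝ} (hv : ∀ j, ∀ x ∈ A j, v x = θ j)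
    (hv' : ∀ x, (∀ j, x ∉ A j) → v x = 1) :
    ∫ ω, infProd (fun n => v (X n ω)) ∂μ = Real.exp (-∫ x, (1 - v x) ∂Λ) := by
  classical
  have hne : ∀ {x j j'}, x ∈ A j → j' ≠ j → x ∉ A j' := fun {x j j'} hx hj hx' =>
    Set.disjoint_left.1 (hdisj hj) hx' hx
  have hprod : ∀ x, v x = ∏ j, if x ∈ A j then θ j else 1 := by
    intro x
    by_cases hx : ∃ j, x ∈ A j
    · obtain ⟨j, hj⟩ := hx
      rw [Finset.prod_eq_single j (fun j' _ hj' => if_neg (hne hj hj')) (by simp), if_pos hj,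
        hv j x hj]
    · push Not at hx
      rw [hv' x hx, Finset.prod_eq_one fun j _ => if_neg (hx j)]
  have hsum : ∀ x, 1 - v x = ∑ j, (A j).indicator (fun _ => 1 - θ j) x := by
    intro x
    by_cases hx : ∃ j, x ∈ A j
    · obtain ⟨j, hj⟩ := hx
      rw [Finset.sum_eq_single j (fun j' _ hj' => Set.indicator_of_notMem (hne hj hj') _)
        (by simp), Set.indicator_of_mem hj, hv j x hj]
    · push Not at hx
      rw [hv' x hx, Finset.sum_eq_zero fun j _ => Set.indicator_of_notMem (hx j) _, sub_self]
  have hv0 : ∀ x, 0 ≤ v x := fun x => by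
    rw [hprod]
    exact Finset.prod_nonneg fun j _ => by split_ifs; exacts [h0 j, zero_le_one]
  have hv1 : ∀ x, v x ≤ 1 := fun x => by
    rw [hprod]
    exact Finset.prod_le_one (fun j _ => by split_ifs; exacts [h0 j, zero_le_one])
      fun j _ => by split_ifs; exacts [h1 j, le_rfl]
  have hae : ∀ᵐ ω ∂μ, infProd (fun n => v (X n ω)) = ∏ j, θ j ^ (pointCount X (A j) ω).toNat := by
    filter_upwards [ae_all_iff.2 fun j => h.finite_points (hA j) (hΛ j)] with ω hω
    refine tendsto_nhds_unique (tendsto_infProd (fun n => hv0 _) fun n => hv1 _) ?_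
    have hcomm : ∀ k, ∏ n ∈ Finset.range k, v (X n ω) =
        ∏ j, ∏ n ∈ Finset.range k, if X n ω ∈ A j then θ j else 1 := by
      intro k
      rw [Finset.prod_comm]
      exact Finset.prod_congr rfl fun n _ => hprod _
    simp_rw [hcomm]
    refine tendsto_finsetProd _ fun j _ => ?_
    obtain ⟨K, hK⟩ := (hω j).bddAbove
    refine tendsto_const_nhds.congr' ?_
    filter_upwards [eventually_gt_atTop K] with k hk
    rw [Finset.prod_ite, Finset.prod_const, Finset.prod_const_one, mul_one]
    congr 1
    rw [pointCount, ← Set.ncard_def, ← Set.ncard_coe_finset]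
    congr 1
    ext n
    simp only [Set.mem_ofPred_eq, Finset.coe_filter, Finset.mem_range]
    exact ⟨fun hn => ⟨(hK hn).trans_lt hk, hn⟩, fun hn => hn.2⟩
  have hindep := h.count_indep m A hA hΛ hdisj
  have hmeas : ∀ j, Measurable (pointCount X (A j)) := fun j =>
    measurable_pointCount h.measurable (hA j)
  rw [integral_congr_ae hae]
  have := (hindep.comp (fun j (c : ℕ∞) => θ j ^ c.toNat)
    fun j => Measurable.of_discrete).integral_fun_prod_eq_prod_integral fun j =>
      ((Measurable.of_discrete (f := fun c : ℕ∞ => θ j ^ c.toNat)).comp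
        (hmeas j)).aestronglyMeasurable
  simp only [Function.comp_apply] at this
  rw [this]
  simp_rw [h.integral_pow_pointCount (hA _) (hΛ _), hsum]
  rw [integral_finsetSum, ← Real.exp_sum, ← Finset.sum_neg_distrib]
  · congr 1
    refine Finset.sum_congr rfl fun j _ => ?_
    rw [integral_indicator_const _ (hA j), smul_eq_mul, mul_comm]
  · intro j _
    exact (integrable_indicator_iff (hA j)).2 (integrableOn_const (hΛ j))

/-- The generating functional of a Poisson process:
`𝔼 ∏ₙ v (X n) = exp (-∫ (1 - v) dΛ)` for `v` with values in `[0, 1]`. -/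
theorem integral_infProd [SigmaFinite Λ] (h : IsPoissonPointProcess X Λ μ) {v : E → ℝ}
    (hv : Measurable v) (h0 : ∀ x, 0 ≤ v x) (h1 : ∀ x, v x ≤ 1)
    (hint : Integrable (fun x => 1 - v x) Λ) :
    ∫ ω, infProd (fun n => v (X n ω)) ∂μ = Real.exp (-∫ x, (1 - v x) ∂Λ) := by
  classical
  -- approximate `1 - v` from below by step functions supported on sets of finite intensity; at
  -- `k = 0` the division by zero gives the step function `0`
  set w : ℕ → E → ℝ := fun k x =>
    if x ∈ spanningSets Λ k then (⌊(1 - v x) * k⌋₊ : ℝ) / k else 0 with hw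
  have hw0 : ∀ k x, 0 ≤ w k x := by
    intro k x
    simp only [hw]
    split_ifs <;> positivity
  have hwv : ∀ k x, w k x ≤ 1 - v x := by
    intro k x
    simp only [hw]
    have h2 : 0 ≤ 1 - v x := sub_nonneg.2 (h1 x)
    split_ifs
    · exact div_le_of_le_mul₀ (by positivity) h2 (Nat.floor_le (by positivity))
    · exact h2
  have hwlim : ∀ x, Tendsto (fun k => w k x) atTop (𝓝 (1 - v x)) := by
    intro x
    have h2 : 0 ≤ 1 - v x := sub_nonneg.2 (h1 x)
    have hx : x ∈ ⋃ k, spanningSets Λ k := by simp [iUnion_spanningSets]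
    obtain ⟨k₀, hk₀⟩ := Set.mem_iUnion.1 hx
    refine ((tendsto_nat_floor_mul_div_atTop h2).comp tendsto_natCast_atTop_atTop).congr' ?_
    filter_upwards [eventually_ge_atTop k₀] with k hk
    simp only [hw, Function.comp_apply]
    rw [if_pos (monotone_spanningSets Λ hk hk₀)]
  have hwm : ∀ k, Measurable (w k) := by
    intro k
    refine Measurable.ite (measurableSet_spanningSets Λ k) ?_ measurable_const
    exact (measurable_from_nat.comp (Nat.measurable_floor.comp
      ((measurable_const.sub hv).mul_const _))).div_const _
  have hstep : ∀ k, ∫ ω, infProd (fun n => 1 - w k (X n ω)) ∂μ = Real.exp (-∫ x, w k x ∂Λ) := by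
    intro k
    have := h.integral_infProd_step (m := k + 1)
      (A := fun j => {x | x ∈ spanningSets Λ k ∧ ⌊(1 - v x) * k⌋₊ = j})
      (θ := fun j => 1 - (j : ℝ) / k) (v := fun x => 1 - w k x) ?_ ?_ ?_ ?_ ?_ ?_ ?_
    · simpa using this
    · intro j
      refine (measurableSet_spanningSets Λ k).inter ?_
      exact (Nat.measurable_floor.comp ((measurable_const.sub hv).mul_const _))
        (MeasurableSet.singleton (j : ℕ))
    · intro j
      exact measure_ne_top_of_subset (fun x hx => hx.1) (measure_spanningSets_lt_top Λ k).ne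
    · intro i j hij
      refine Set.disjoint_left.2 fun x hi hj => hij ?_
      exact Fin.ext (hi.2.symm.trans hj.2)
    · intro j
      have : (j : ℝ) ≤ k := by exact_mod_cast Nat.lt_succ_iff.1 j.2
      exact sub_nonneg.2 (div_le_one_of_le₀ this (by positivity))
    · intro j
      have : 0 ≤ (j : ℝ) / k := by positivity
      linarith
    · rintro j x ⟨hx, hj⟩
      simp only [hw]
      rw [if_pos hx, hj]
    · intro x hx
      by_cases hxk : x ∈ spanningSets Λ k
      · exfalso
        have hle : ⌊(1 - v x) * k⌋₊ ≤ k := by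
          refine Nat.floor_le_of_le (mul_le_of_le_one_left (by positivity) ?_)
          linarith [h0 x]
        exact hx ⟨_, Nat.lt_succ_of_le hle⟩ ⟨hxk, rfl⟩
      · simp [hw, hxk]
  have hlim1 : Tendsto (fun k => Real.exp (-∫ x, w k x ∂Λ)) atTop
      (𝓝 (Real.exp (-∫ x, (1 - v x) ∂Λ))) := by
    refine (Real.continuous_exp.tendsto _).comp (Tendsto.neg ?_)
    refine tendsto_integral_of_dominated_convergence (fun x => 1 - v x)
      (fun k => (hwm k).aestronglyMeasurable) hint (fun k => Eventually.of_forall fun x => ?_)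
      (Eventually.of_forall hwlim)
    rw [Real.norm_of_nonneg (hw0 k x)]
    exact hwv k x
  have hf0 : ∀ k x, 0 ≤ 1 - w k x := fun k x => by linarith [hwv k x, h0 x]
  have hf1 : ∀ k x, 1 - w k x ≤ 1 := fun k x => by linarith [hw0 k x]
  have hlim2 : Tendsto (fun k => ∫ ω, infProd (fun n => 1 - w k (X n ω)) ∂μ) atTop
      (𝓝 (∫ ω, infProd (fun n => v (X n ω)) ∂μ)) := by
    refine tendsto_integral_of_dominated_convergence (fun _ => 1)
      (fun k => (measurable_infProd fun n =>
        (measurable_const.sub (hwm k)).comp (h.measurable n)).aestronglyMeasurable)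
      (integrable_const _) (fun k => Eventually.of_forall fun ω => ?_)
      (Eventually.of_forall fun ω => ?_)
    · rw [Real.norm_of_nonneg (infProd_nonneg fun n => hf0 k _)]
      exact infProd_le_one fun n => hf0 k _
    · -- the approximating products lie above the limit, and below any partial product eventually
      refine tendsto_order.2 ⟨fun c hc => Eventually.of_forall fun k => hc.trans_le ?_,
        fun c hc => ?_⟩
      · exact infProd_mono (fun n => h0 _) fun n => by linarith [hwv k (X n ω)]
      · obtain ⟨m, hm⟩ := ((tendsto_infProd (fun n => h0 (X n ω))
          fun n => h1 (X n ω)).eventually_lt_const hc).exists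
        have : Tendsto (fun k => ∏ n ∈ Finset.range m, (1 - w k (X n ω))) atTop
            (𝓝 (∏ n ∈ Finset.range m, v (X n ω))) := by
          refine tendsto_finsetProd _ fun n _ => ?_
          simpa using (hwlim (X n ω)).const_sub 1
        filter_upwards [this.eventually_lt_const hm] with k hk
        exact (infProd_le (fun n => hf0 k _) m).trans_lt hk
  simp_rw [hstep] at hlim2
  exact tendsto_nhds_unique hlim2 hlim1

end IsPoissonPointProcess
end Poisson

/-! ### Planar integrals and the hypergeometric function -/

namespace RadioSystem

variable (S : RadioSystem)

theorem β_pos : 0 < S.β := by linarith [S.two_lt_β]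

theorem Tbar_pos : 0 < S.Tbar := by
  have h : 0 < S.T / (S.τ * S.B) := div_pos S.T_pos (mul_pos S.τ_pos S.B_pos)
  have := Real.one_lt_rpow (x := 2) (by norm_num) h
  rw [Tbar]
  linarith

theorem exponent_pos : 0 < 1 - 2 / S.β := by
  have := (div_lt_one S.β_pos).2 S.two_lt_β
  linarith

theorem Z1_eq (x : ℝ) : S.Z1 x = 2 / S.β * S.Tbar ^ (2 / S.β) * x ^ (1 - 2 / S.β) *
    ∫ t in (0 : ℝ)..1, t ^ (-(2 / S.β)) / (1 + x * t) := by
  have hβ := S.β_pos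
  have hβ2 : S.β - 2 ≠ 0 := by linarith [S.two_lt_β]
  have hb := S.exponent_pos
  have hG := (Real.Gamma_pos_of_pos hb).ne'
  have hint : ∫ t in (0 : ℝ)..1, t ^ (1 - 2 / S.β - 1) *
      (1 - t) ^ (2 - 2 / S.β - (1 - 2 / S.β) - 1) * (1 - -x * t) ^ (-1 : ℝ) =
      ∫ t in (0 : ℝ)..1, t ^ (-(2 / S.β)) / (1 + x * t) := by
    refine intervalIntegral.integral_congr fun t _ => ?_
    rw [show 2 - 2 / S.β - (1 - 2 / S.β) - 1 = 0 by ring, Real.rpow_zero, mul_one,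
      show 1 - 2 / S.β - 1 = -(2 / S.β) by ring, Real.rpow_neg_one, div_eq_mul_inv]
    ring_nf
  have hΓ : Real.Gamma (2 - 2 / S.β) = (1 - 2 / S.β) * Real.Gamma (1 - 2 / S.β) := by
    rw [← Real.Gamma_add_one hb.ne']
    ring_nf
  rw [Z1, gaussHypergeometric, hint, show 2 - 2 / S.β - (1 - 2 / S.β) = 1 by ring,
    Real.Gamma_one, hΓ]
  have h1 : (1 - 2 / S.β) = (S.β - 2) / S.β := by field_simp
  generalize Real.Gamma (1 - 2 / S.β) = G at hG ⊢
  generalize x ^ (1 - 2 / S.β) = y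
  rw [h1]
  field_simp

theorem continuousOn_Z1 : ContinuousOn S.Z1 (Set.Ici 0) := by
  have hb := S.exponent_pos
  have h := (gaussHypergeometric_analyticOnNhd (a := 1) hb
    (show 1 - 2 / S.β < 2 - 2 / S.β by linarith)).continuousOn
  have hrpow : Continuous fun x : ℝ => x ^ (1 - 2 / S.β) := Real.continuous_rpow_const hb.le
  refine ContinuousOn.mul ?_ (h.comp (continuous_neg.continuousOn) fun x hx => ?_)
  · exact ((continuous_const.mul hrpow).div_const _).continuousOn
  · have : (0 : ℝ) ≤ x := hx
    simp only [Set.mem_Iio]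
    linarith

/-- `1 - 𝔼 exp (-T̄ r ^ β d ^ (-β) |h| ^ 2)` for a Rayleigh coefficient `h`: what an interferer at
distance `d` takes off the success probability of a user served from distance `r`. -/
noncomputable def damping (r d : ℝ) : ℝ :=
  S.Tbar * r ^ S.β * d ^ (-S.β) / (1 + S.Tbar * r ^ S.β * d ^ (-S.β))

variable {S}

theorem damping_nonneg {r d : ℝ} (hr : 0 ≤ r) (hd : 0 ≤ d) : 0 ≤ S.damping r d := by
  have := S.Tbar_pos
  rw [damping]
  positivity

theorem damping_le_one {r d : ℝ} (hr : 0 ≤ r) (hd : 0 ≤ d) : S.damping r d ≤ 1 := by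
  have := S.Tbar_pos
  rw [damping]
  have h : 0 ≤ S.Tbar * r ^ S.β * d ^ (-S.β) := by positivity
  exact div_le_one_of_le₀ (by linarith) (by linarith)

theorem damping_mono {r r' d : ℝ} (hr : 0 ≤ r) (h : r ≤ r') (hd : 0 ≤ d) :
    S.damping r d ≤ S.damping r' d := by
  have hT := S.Tbar_pos
  have hβ := S.β_pos
  have h1 : S.Tbar * r ^ S.β * d ^ (-S.β) ≤ S.Tbar * r' ^ S.β * d ^ (-S.β) := by gcongr
  have h0 : 0 ≤ S.Tbar * r ^ S.β * d ^ (-S.β) := by positivity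
  rw [damping, damping, div_le_div_iff₀ (by linarith) (by linarith)]
  linarith

theorem damping_le {r d : ℝ} (hr : 0 ≤ r) (hd : 0 ≤ d) :
    S.damping r d ≤ S.Tbar * r ^ S.β * d ^ (-S.β) := by
  have hT := S.Tbar_pos
  have h0 : 0 ≤ S.Tbar * r ^ S.β * d ^ (-S.β) := by positivity
  exact div_le_self h0 (by linarith)

@[fun_prop]
theorem measurable_damping (r : ℝ) : Measurable (S.damping r) := by
  unfold damping
  fun_prop

end RadioSystem

theorem integrable_rpow_norm_of_lt {β ρ : ℝ} (hβ : 2 < β) (hρ : 0 < ρ) :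
    Integrable fun y : Plane => Set.indicator (Set.Ioi ρ) (fun d : ℝ => d ^ (-β)) ‖y‖ := by
  rw [integrable_fun_norm_addHaar (μ := (volume : Measure Plane))
    (f := Set.indicator (Set.Ioi ρ) fun d : ℝ => d ^ (-β))]
  have h : IntegrableOn (fun d : ℝ => d ^ (1 - β)) (Set.Ioi ρ) :=
    integrableOn_Ioi_rpow_of_lt (by linarith) hρ
  have h2 := (integrable_indicator_iff measurableSet_Ioi).2 h
  refine h2.integrableOn.congr_fun (fun d hd => ?_) measurableSet_Ioi
  have hd' : (0 : ℝ) < d := hd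
  by_cases hdρ : d ∈ Set.Ioi ρ
  · simp only [Set.indicator_of_mem hdρ, finrank_euclideanSpace, Fintype.card_fin, smul_eq_mul]
    rw [show 1 - β = 1 + -β by ring, Real.rpow_add hd', Real.rpow_one]
    norm_num
  · simp [Set.indicator_of_notMem hdρ]

namespace RadioSystem

variable {S : RadioSystem}

theorem integrable_damping {r ρ : ℝ} (hr : 0 ≤ r) (hρ : 0 < ρ) :
    Integrable fun y : Plane => Set.indicator (Set.Ioi ρ) (S.damping r) ‖y‖ := by
  refine ((integrable_rpow_norm_of_lt S.two_lt_β hρ).const_mul (S.Tbar * r ^ S.β)).mono'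
    (((measurable_damping r).indicator measurableSet_Ioi).comp
      measurable_norm).aestronglyMeasurable (Eventually.of_forall fun y => ?_)
  by_cases hy : ‖y‖ ∈ Set.Ioi ρ
  · rw [Set.indicator_of_mem hy, Set.indicator_of_mem hy,
      Real.norm_of_nonneg (damping_nonneg hr (norm_nonneg y))]
    exact damping_le hr (norm_nonneg y)
  · simp [Set.indicator_of_notMem hy]

theorem integral_mul_damping {r ρ : ℝ} (hr : 0 < r) (hρ : 0 < ρ) :
    ∫ x in Set.Ioi (0 : ℝ), x * Set.indicator (Set.Ioi ρ) (S.damping r) x =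
      r ^ 2 / 2 * S.Z1 ((r / ρ) ^ S.β * S.Tbar) := by
  have hβ := S.β_pos
  have hT := S.Tbar_pos
  set c := S.Tbar * r ^ S.β with hc
  have hc0 : 0 < c := by positivity
  -- the substitution `t = x ^ (-β)`, followed by a rescaling to the unit interval
  have hsub := integral_comp_rpow_Ioi
    (Set.indicator (Set.Iio (ρ ^ (-S.β))) fun t : ℝ => t ^ (-(2 / S.β)) / (1 + c * t))
    (neg_ne_zero.2 hβ.ne')
  have hleft : ∀ x ∈ Set.Ioi (0 : ℝ), (|(-S.β)| * x ^ (-S.β - 1)) •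
      Set.indicator (Set.Iio (ρ ^ (-S.β))) (fun t : ℝ => t ^ (-(2 / S.β)) / (1 + c * t))
        (x ^ (-S.β)) = S.β / c * (x * Set.indicator (Set.Ioi ρ) (S.damping r) x) := by
    intro x hx
    have hx0 : (0 : ℝ) < x := hx
    have hiff : x ^ (-S.β) ∈ Set.Iio (ρ ^ (-S.β)) ↔ x ∈ Set.Ioi ρ := by
      simp only [Set.mem_Iio, Set.mem_Ioi]
      exact Real.rpow_lt_rpow_iff_of_neg hx0 hρ (neg_neg_of_pos hβ)
    by_cases hxρ : x ∈ Set.Ioi ρ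
    · rw [Set.indicator_of_mem (hiff.2 hxρ), Set.indicator_of_mem hxρ, damping, ← hc, abs_neg,
        abs_of_pos hβ, smul_eq_mul, ← Real.rpow_mul hx0.le]
      have h1 : x ^ (-S.β * -(2 / S.β)) = x ^ 2 := by
        rw [← Real.rpow_natCast]
        congr 1
        field_simp
        norm_num
      have h2 : x ^ (-S.β - 1) = x ^ (-S.β) / x := by
        rw [Real.rpow_sub hx0, Real.rpow_one]
      rw [h1, h2]
      have : 1 + c * x ^ (-S.β) ≠ 0 := by positivity
      field_simp
    · rw [Set.indicator_of_notMem (fun h => hxρ (hiff.1 h)), Set.indicator_of_notMem hxρ]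
      simp
  rw [setIntegral_congr_fun measurableSet_Ioi hleft, integral_const_mul,
    setIntegral_indicator measurableSet_Iio, Set.Ioi_inter_Iio, ← integral_Ioc_eq_integral_Ioo,
    ← intervalIntegral.integral_of_le (by positivity)] at hsub
  have hscale := intervalIntegral.smul_integral_comp_mul_left (a := 0) (b := 1)
    (fun t : ℝ => t ^ (-(2 / S.β)) / (1 + c * t)) (ρ ^ (-S.β))
  rw [mul_zero, mul_one] at hscale
  rw [← hscale] at hsub
  have hy : (r / ρ) ^ S.β * S.Tbar = c * ρ ^ (-S.β) := by
    rw [Real.div_rpow hr.le hρ.le, Real.rpow_neg hρ.le, hc]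
    ring
  set y := (r / ρ) ^ S.β * S.Tbar with hyd
  have hy0 : 0 < y := by positivity
  have hint : ∫ t in (0 : ℝ)..1, (ρ ^ (-S.β) * t) ^ (-(2 / S.β)) / (1 + c * (ρ ^ (-S.β) * t)) =
      ρ ^ 2 * ∫ t in (0 : ℝ)..1, t ^ (-(2 / S.β)) / (1 + y * t) := by
    rw [← intervalIntegral.integral_const_mul]
    refine intervalIntegral.integral_congr fun t ht => ?_
    rw [Set.uIcc_of_le zero_le_one] at ht
    have h1 : (ρ ^ (-S.β)) ^ (-(2 / S.β)) = ρ ^ 2 := by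
      rw [← Real.rpow_mul hρ.le, ← Real.rpow_natCast]
      congr 1
      field_simp
      norm_num
    rw [Real.mul_rpow (by positivity) ht.1, h1, hy, ← mul_assoc c, mul_div_assoc]
  rw [hint, smul_eq_mul] at hsub
  have hexp : r ^ 2 * S.Tbar ^ (2 / S.β) * y ^ (1 - 2 / S.β) = ρ ^ 2 * y := by
    have h1 : y ^ (2 / S.β) = (r / ρ) ^ 2 * S.Tbar ^ (2 / S.β) := by
      rw [hyd, Real.mul_rpow (by positivity) hT.le, ← Real.rpow_mul (by positivity),
        ← Real.rpow_natCast (r / ρ)]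
      congr 2
      field_simp
      norm_num
    rw [Real.rpow_sub hy0, Real.rpow_one, h1]
    have : S.Tbar ^ (2 / S.β) ≠ 0 := by positivity
    field_simp
  set I := ∫ t in (0 : ℝ)..1, t ^ (-(2 / S.β)) / (1 + y * t)
  set J := ∫ x in Set.Ioi (0 : ℝ), x * Set.indicator (Set.Ioi ρ) (S.damping r) x
  have hJ : J = c / S.β * (ρ ^ (-S.β) * (ρ ^ 2 * I)) := by
    rw [← hsub]
    field_simp
  rw [hJ, Z1_eq]
  calc c / S.β * (ρ ^ (-S.β) * (ρ ^ 2 * I))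
      = ρ ^ 2 * (c * ρ ^ (-S.β)) * I / S.β := by ring
    _ = r ^ 2 * S.Tbar ^ (2 / S.β) * y ^ (1 - 2 / S.β) * I / S.β := by rw [← hy, hexp]
    _ = _ := by ring

/-- The function `Z₁` collects the interference from beyond a distance `ρ`. -/
theorem integral_damping {r ρ : ℝ} (hr : 0 < r) (hρ : 0 < ρ) :
    ∫ y : Plane, Set.indicator (Set.Ioi ρ) (S.damping r) ‖y‖ =
      Real.pi * r ^ 2 * S.Z1 ((r / ρ) ^ S.β * S.Tbar) := by
  rw [integral_fun_norm_addHaar (volume : Measure Plane) (Set.indicator (Set.Ioi ρ) (S.damping r))]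
  simp only [finrank_euclideanSpace, Fintype.card_fin, smul_eq_mul, pow_one, nsmul_eq_mul,
    Nat.reduceSub, measureReal_def, EuclideanSpace.volume_ball_fin_two]
  rw [integral_mul_damping hr hρ]
  simp [ENNReal.toReal_ofReal Real.pi_pos.le]
  ring

end RadioSystem

/-! ### Rayleigh fading and independent marks -/

theorem hasDerivAt_exp_neg_mul_sq {q : ℝ} (hq : 0 < q) (x : ℝ) :
    HasDerivAt (fun x : ℝ => -(Real.exp (-(q * x ^ 2)) / q)) (2 * x * Real.exp (-(q * x ^ 2))) x := by
  have h0 : HasDerivAt (fun x : ℝ => -(q * x ^ 2)) (-(q * (2 * x))) x := by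
    simpa using ((hasDerivAt_pow 2 x).const_mul q).fun_neg
  refine (h0.exp.div_const q).fun_neg.congr_deriv ?_
  field_simp

theorem lintegral_Ioi_mul_exp_neg_sq {q u : ℝ} (hq : 0 < q) (hu : 0 ≤ u) :
    ∫⁻ x in Set.Ioi u, ENNReal.ofReal (2 * x * Real.exp (-(q * x ^ 2))) =
      ENNReal.ofReal (Real.exp (-(q * u ^ 2)) / q) := by
  have hpos : ∀ x ∈ Set.Ioi u, 0 ≤ 2 * x * Real.exp (-(q * x ^ 2)) := fun x hx => by
    have : 0 < x := hu.trans_lt hx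
    positivity
  have hlim : Tendsto (fun x : ℝ => -(Real.exp (-(q * x ^ 2)) / q)) atTop (𝓝 (-(0 / q))) := by
    refine (Tendsto.div_const ?_ q).neg
    refine Real.tendsto_exp_neg_atTop_nhds_zero.comp ?_
    exact (tendsto_pow_atTop two_ne_zero).const_mul_atTop hq
  have hder := fun x (_ : x ∈ Set.Ici u) => hasDerivAt_exp_neg_mul_sq hq x
  rw [← ofReal_integral_eq_lintegral_ofReal (integrableOn_Ioi_deriv_of_nonneg' hder hpos hlim)
    ((ae_restrict_iff' measurableSet_Ioi).2 (Eventually.of_forall hpos)),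
    integral_Ioi_of_hasDerivAt_of_nonneg' hder hpos hlim]
  simp

theorem measurable_rayleighDensity (w : ℝ) : Measurable fun x : ℝ =>
    ENNReal.ofReal (if 0 ≤ x then 2 * x / w * Real.exp (-x ^ 2 / w) else 0) :=
  (Measurable.ite measurableSet_Ici (by fun_prop) measurable_const).ennreal_ofReal

theorem lintegral_rayleighMeasure_one {f : ℝ → ℝ≥0∞} (hf : Measurable f) :
    ∫⁻ x, f x ∂rayleighMeasure 1 =
      ∫⁻ x in Set.Ioi 0, ENNReal.ofReal (2 * x * Real.exp (-(1 * x ^ 2))) * f x := by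
  rw [rayleighMeasure, lintegral_withDensity_eq_lintegral_mul _ (measurable_rayleighDensity 1) hf,
    ← lintegral_indicator measurableSet_Ioi]
  refine lintegral_congr fun x => ?_
  rcases lt_trichotomy x 0 with hx | hx | hx
  · rw [Set.indicator_of_notMem (by simpa using hx.le)]
    simp [not_le.2 hx]
  · simp [hx]
  · rw [Set.indicator_of_mem (Set.mem_Ioi.2 hx)]
    simp [hx.le]

/-- The squared modulus of a Rayleigh variable is exponentially distributed. -/
theorem rayleighMeasure_one_tail {z : ℝ} (hz : 0 ≤ z) :
    rayleighMeasure 1 {x | z ≤ x ^ 2} = ENNReal.ofReal (Real.exp (-z)) := by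
  have hm : MeasurableSet {x : ℝ | z ≤ x ^ 2} := measurableSet_le measurable_const (by fun_prop)
  rw [← lintegral_indicator_one hm,
    lintegral_rayleighMeasure_one (measurable_one.indicator hm)]
  have h1 : ∫⁻ x in Set.Ioi (0 : ℝ), ENNReal.ofReal (2 * x * Real.exp (-(1 * x ^ 2))) *
      {x : ℝ | z ≤ x ^ 2}.indicator 1 x =
      ∫⁻ x in Set.Ici √z, ENNReal.ofReal (2 * x * Real.exp (-(1 * x ^ 2))) := by
    rw [← lintegral_indicator measurableSet_Ioi, ← lintegral_indicator measurableSet_Ici]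
    refine lintegral_congr fun x => ?_
    rcases le_or_gt x 0 with hx | hx
    · rw [Set.indicator_of_notMem (by simpa using hx)]
      by_cases hx' : x ∈ Set.Ici √z
      · have : x = 0 := le_antisymm hx ((Real.sqrt_nonneg z).trans hx')
        simp [this, Set.indicator_apply]
      · rw [Set.indicator_of_notMem hx']
    · rw [Set.indicator_of_mem (Set.mem_Ioi.2 hx)]
      have hiff : x ∈ {x : ℝ | z ≤ x ^ 2} ↔ x ∈ Set.Ici √z := by
        simp only [Set.mem_ofPred_eq, Set.mem_Ici]
        exact (Real.sqrt_le_left hx.le).symm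
      by_cases hx' : x ∈ Set.Ici √z
      · simp [Set.indicator_of_mem hx', Set.indicator_of_mem (hiff.2 hx')]
      · simp [Set.indicator_of_notMem hx', Set.indicator_of_notMem (fun h => hx' (hiff.1 h))]
  rw [h1, setLIntegral_congr Ioi_ae_eq_Ici.symm,
    lintegral_Ioi_mul_exp_neg_sq one_pos (Real.sqrt_nonneg z), Real.sq_sqrt hz]
  simp

theorem lintegral_exp_neg_rayleighMeasure_one {a : ℝ} (ha : 0 ≤ a) :
    ∫⁻ x, ENNReal.ofReal (Real.exp (-(a * x ^ 2))) ∂rayleighMeasure 1 =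
      ENNReal.ofReal (1 / (1 + a)) := by
  rw [lintegral_rayleighMeasure_one (by fun_prop)]
  have h := lintegral_Ioi_mul_exp_neg_sq (q := 1 + a) (by linarith) le_rfl
  simp only [ne_eq, OfNat.ofNat_ne_zero, not_false_eq_true, zero_pow, mul_zero, neg_zero,
    Real.exp_zero] at h
  rw [← h]
  refine setLIntegral_congr_fun measurableSet_Ioi fun x hx => ?_
  have hx0 : (0 : ℝ) < x := hx
  rw [← ENNReal.ofReal_mul (by positivity), mul_assoc, ← Real.exp_add]
  ring_nf

theorem lintegral_sq_rayleighMeasure_one_lt_top :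
    ∫⁻ x, ENNReal.ofReal (x ^ 2) ∂rayleighMeasure 1 < ∞ := by
  rw [lintegral_rayleighMeasure_one (by fun_prop)]
  have h := lintegral_Ioi_mul_exp_neg_sq (q := 1 / 2) (by norm_num) le_rfl
  have hle : ∫⁻ x in Set.Ioi (0 : ℝ), ENNReal.ofReal (2 * x * Real.exp (-(1 * x ^ 2))) *
      ENNReal.ofReal (x ^ 2) ≤ ∫⁻ x in Set.Ioi (0 : ℝ),
        2 * ENNReal.ofReal (2 * x * Real.exp (-(1 / 2 * x ^ 2))) := by
    refine setLIntegral_mono (by fun_prop) fun x hx => ?_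
    have hx0 : (0 : ℝ) < x := hx
    rw [← ENNReal.ofReal_mul (by positivity), ← ENNReal.ofReal_ofNat 2,
      ← ENNReal.ofReal_mul (by norm_num)]
    refine ENNReal.ofReal_le_ofReal ?_
    have h1 : x ^ 2 ≤ 2 * Real.exp (1 / 2 * x ^ 2) := by
      linarith [Real.add_one_le_exp (1 / 2 * x ^ 2)]
    calc 2 * x * Real.exp (-(1 * x ^ 2)) * x ^ 2
        ≤ 2 * x * Real.exp (-(1 * x ^ 2)) * (2 * Real.exp (1 / 2 * x ^ 2)) := by gcongr
      _ = 2 * (2 * x * (Real.exp (-(1 * x ^ 2)) * Real.exp (1 / 2 * x ^ 2))) := by ring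
      _ = 2 * (2 * x * Real.exp (-(1 / 2 * x ^ 2))) := by
        rw [← Real.exp_add]
        ring_nf
  refine hle.trans_lt ?_
  rw [lintegral_const_mul _ (by fun_prop), h]
  exact ENNReal.mul_lt_top (by simp) ENNReal.ofReal_lt_top

section Marks

variable {Ω : Type*} [MeasurableSpace Ω] {μ : Measure Ω}

/-- Conditioning on the first of two independent variables. -/
theorem measure_pair_mem_eq_lintegral [IsProbabilityMeasure μ] {α β : Type*} [MeasurableSpace α] [MeasurableSpace β]
    {f : Ω → α} {g : Ω → β} (hf : Measurable f) (hg : Measurable g) (h : IndepFun f g μ)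
    {s : Set (α × β)} (hs : MeasurableSet s) :
    μ {ω | (f ω, g ω) ∈ s} = ∫⁻ ω, μ {ω' | (f ω, g ω') ∈ s} ∂μ := by
  have : IsProbabilityMeasure (μ.map g) := Measure.isProbabilityMeasure_map hg.aemeasurable
  have : IsProbabilityMeasure (μ.map f) := Measure.isProbabilityMeasure_map hf.aemeasurable
  calc μ {ω | (f ω, g ω) ∈ s} = μ.map (fun ω => (f ω, g ω)) s :=
        (Measure.map_apply (hf.prodMk hg) hs).symm
    _ = ∫⁻ x, μ.map g (Prod.mk x ⁻¹' s) ∂μ.map f := by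
        rw [h.map_prod_eq_prod_map_map hf.aemeasurable hg.aemeasurable, Measure.prod_apply hs]
    _ = ∫⁻ ω, μ.map g (Prod.mk (f ω) ⁻¹' s) ∂μ :=
        lintegral_map (measurable_measure_prodMk_left hs) hf
    _ = _ := lintegral_congr fun ω => Measure.map_apply hg (measurable_prodMk_left hs)

variable {H : Ω → ℂ}

theorem measure_fading_tail (hH : Measurable H)
    (hlaw : μ.map (fun ω => ‖H ω‖) = rayleighMeasure 1) {z : ℝ} (hz : 0 ≤ z) :
    μ {ω | z ≤ ‖H ω‖ ^ 2} = ENNReal.ofReal (Real.exp (-z)) := by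
  rw [← rayleighMeasure_one_tail hz, ← hlaw,
    Measure.map_apply hH.norm (measurableSet_le measurable_const (by fun_prop))]
  rfl

/-- An exponential variable exceeds an independent variable `Z ≥ 0` with probability
`𝔼 exp (-Z)`. -/
theorem measureReal_le_fading [IsProbabilityMeasure μ] (hH : Measurable H)
    (hlaw : μ.map (fun ω => ‖H ω‖) = rayleighMeasure 1) {Z : Ω → ℝ} (hZ : Measurable Z)
    (hZ0 : ∀ ω, 0 ≤ Z ω) (hind : IndepFun Z (fun ω => ‖H ω‖ ^ 2) μ) :
    μ.real {ω | Z ω ≤ ‖H ω‖ ^ 2} = ∫ ω, Real.exp (-Z ω) ∂μ := by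
  have h := measure_pair_mem_eq_lintegral hZ (hH.norm.pow_const 2) hind
    (s := {p : ℝ × ℝ | p.1 ≤ p.2}) (measurableSet_le measurable_fst measurable_snd)
  simp only [Set.mem_ofPred_eq] at h
  rw [measureReal_def, h, integral_eq_lintegral_of_nonneg_ae
    (Eventually.of_forall fun ω => (Real.exp_pos _).le) (by fun_prop)]
  congr 1
  exact lintegral_congr fun ω => measure_fading_tail hH hlaw (hZ0 ω)

theorem integral_exp_neg_fading (hH : Measurable H)
    (hlaw : μ.map (fun ω => ‖H ω‖) = rayleighMeasure 1) {a : ℝ} (ha : 0 ≤ a) :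
    ∫ ω, Real.exp (-(a * ‖H ω‖ ^ 2)) ∂μ = 1 / (1 + a) := by
  rw [integral_eq_lintegral_of_nonneg_ae (Eventually.of_forall fun ω => (Real.exp_pos _).le)
    (by fun_prop)]
  have := lintegral_map (μ := μ) (g := fun ω => ‖H ω‖)
    (f := fun x : ℝ => ENNReal.ofReal (Real.exp (-(a * x ^ 2)))) (by fun_prop) hH.norm
  rw [← this, hlaw, lintegral_exp_neg_rayleighMeasure_one ha,
    ENNReal.toReal_ofReal (by positivity)]

end Marks

namespace IsDownlinkModel

variable {Ω : Type*} [MeasurableSpace Ω] {N M : ℕ} {C : CachingScheme N M} {S : RadioSystem}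
  {μ : Measure Ω} [IsProbabilityMeasure μ] {X : ℕ → Ω → Plane} {K : ℕ → Ω → Fin N}
  {H : ℕ → Ω → ℂ}

theorem packet_mem_law (h : IsDownlinkModel C S μ X K H) (n : ℕ) (A : Finset (Fin N)) :
    μ.real {ω | K n ω ∈ A} = ∑ j ∈ A, C.alpha j := by
  have hU : {ω | K n ω ∈ A} = ⋃ j ∈ A, {ω | K n ω = j} := by
    ext ω
    simp
  rw [hU, measureReal_biUnion_finset]
  · exact Finset.sum_congr rfl fun j _ => h.packet_law n j
  · intro j _ j' _ hjj'
    exact Set.disjoint_left.2 fun ω h1 h2 => hjj' (h1.symm.trans h2)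
  · exact fun j _ => h.measurable_packet n (MeasurableSet.singleton j)

theorem sum_alpha_nonneg (h : IsDownlinkModel C S μ X K H) (A : Finset (Fin N)) :
    0 ≤ ∑ j ∈ A, C.alpha j := by
  rw [← h.packet_mem_law 0 A]
  exact measureReal_nonneg

theorem sum_alpha_le_one (h : IsDownlinkModel C S μ X K H) (A : Finset (Fin N)) :
    ∑ j ∈ A, C.alpha j ≤ 1 := by
  rw [← h.packet_mem_law 0 A]
  exact measureReal_le_one

theorem sum_alpha_univ (h : IsDownlinkModel C S μ X K H) : ∑ j, C.alpha j = 1 := by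
  rw [← h.packet_mem_law 0 Finset.univ]
  simp

/-- The Laplace transform of the power, scaled to mean `d`, of a base station that counts only if
its packet lies in `A`. -/
theorem integral_exp_neg_mark (h : IsDownlinkModel C S μ X K H) (n : ℕ) (A : Finset (Fin N))
    {d : ℝ} (hd : 0 ≤ d) :
    ∫ ω, Real.exp (-(if K n ω ∈ A then d * ‖H n ω‖ ^ 2 else 0)) ∂μ =
      1 - (∑ j ∈ A, C.alpha j) * (d / (1 + d)) := by
  have hH := h.measurable_fading n
  set ψ : Fin N → ℝ := fun j => if j ∈ A then 1 else 0 with hψ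
  have hpt : ∀ ω, Real.exp (-(if K n ω ∈ A then d * ‖H n ω‖ ^ 2 else 0)) =
      1 - ψ (K n ω) * (1 - Real.exp (-(d * ‖H n ω‖ ^ 2))) := by
    intro ω
    simp only [hψ]
    split_ifs <;> simp
  have hind : IndepFun (fun ω => ψ (K n ω)) (fun ω => 1 - Real.exp (-(d * ‖H n ω‖ ^ 2))) μ :=
    (h.packet_indep_fading n).comp (φ := ψ) (ψ := fun z : ℂ => 1 - Real.exp (-(d * ‖z‖ ^ 2)))
      Measurable.of_discrete (by fun_prop)
  have hm1 : Measurable fun ω => ψ (K n ω) :=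
    (Measurable.of_discrete (f := ψ)).comp (h.measurable_packet n)
  have hm2 : Measurable fun ω => 1 - Real.exp (-(d * ‖H n ω‖ ^ 2)) := by fun_prop
  have hexp1 : ∀ ω, Real.exp (-(d * ‖H n ω‖ ^ 2)) ≤ 1 := fun ω =>
    Real.exp_le_one_iff.2 (neg_nonpos.2 (by positivity))
  have hi1 : Integrable (fun ω => ψ (K n ω)) μ := by
    refine Integrable.of_bound hm1.aestronglyMeasurable 1 (Eventually.of_forall fun ω => ?_)
    simp only [hψ]
    split_ifs <;> simp
  have hi3 : Integrable (fun ω => Real.exp (-(d * ‖H n ω‖ ^ 2))) μ := by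
    refine Integrable.of_bound (by fun_prop) 1 (Eventually.of_forall fun ω => ?_)
    rw [Real.norm_of_nonneg (Real.exp_pos _).le]
    exact hexp1 ω
  have hi2 : Integrable (fun ω => 1 - Real.exp (-(d * ‖H n ω‖ ^ 2))) μ :=
    (integrable_const 1).sub hi3
  have hψint : ∫ ω, ψ (K n ω) ∂μ = ∑ j ∈ A, C.alpha j := by
    rw [← h.packet_mem_law n A, ← integral_indicator_one
      (show MeasurableSet {ω | K n ω ∈ A} from
        h.measurable_packet n (MeasurableSet.of_discrete (s := (A : Set (Fin N)))))]
    refine integral_congr_ae (Eventually.of_forall fun ω => ?_)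
    simp [hψ, Set.indicator_apply]
  simp_rw [hpt]
  rw [integral_sub (integrable_const 1) (show Integrable (fun ω => ψ (K n ω) *
    (1 - Real.exp (-(d * ‖H n ω‖ ^ 2)))) μ from hind.integrable_mul hi1 hi2),
    hind.integral_fun_mul_eq_mul_integral hm1.aestronglyMeasurable hm2.aestronglyMeasurable, hψint,
    integral_sub (integrable_const 1) hi3, integral_exp_neg_fading hH (h.fading_law n) hd]
  have : 1 + d ≠ 0 := by positivity
  rw [integral_const, probReal_univ, one_smul]
  field_simp
  ring

/-- Given the locations, success has the probability of the serving signal exceeding the weighted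
interference, which factorizes over the interferers. The interference enters through its partial
sums, so that independence is used for finite sums only and the limit is continuity from above. -/
theorem measureReal_forall_partial_sum_le (h : IsDownlinkModel C S μ X K H) (n₀ : ℕ)
    (A : ℕ → Finset (Fin N)) {d : ℕ → ℝ} (hd : ∀ m, 0 ≤ d m) {b : ℝ} (hb : 0 ≤ b) :
    μ.real {ω | ∀ k, ∑ m ∈ (Finset.range k).erase n₀,
        (if K m ω ∈ A m then d m * ‖H m ω‖ ^ 2 else 0) + b ≤ ‖H n₀ ω‖ ^ 2} =
      Real.exp (-b) * infProd fun m =>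
        if m = n₀ then 1 else 1 - (∑ j ∈ A m, C.alpha j) * (d m / (1 + d m)) := by
  set φ : ℕ → Fin N × ℂ → ℝ := fun m p => if p.1 ∈ A m then d m * ‖p.2‖ ^ 2 else 0 with hφ
  have hφm : ∀ m, Measurable (φ m) := fun m => by
    refine Measurable.ite ?_ (by fun_prop) measurable_const
    exact measurable_fst (MeasurableSet.of_discrete (s := (A m : Set (Fin N))))
  have hφ0 : ∀ m p, 0 ≤ φ m p := fun m p => by
    simp only [hφ]
    have := hd m
    split_ifs <;> positivity
  have hmark : ∀ m, Measurable fun ω => (K m ω, H m ω) := fun m =>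
    (h.measurable_packet m).prodMk (h.measurable_fading m)
  set v : ℕ → ℝ := fun m => 1 - (∑ j ∈ A m, C.alpha j) * (d m / (1 + d m)) with hv
  set Z : ℕ → Ω → ℝ := fun k ω => ∑ m ∈ (Finset.range k).erase n₀, φ m (K m ω, H m ω) + b with hZ
  have hZm : ∀ k, Measurable (Z k) := fun k =>
    (Finset.measurable_fun_sum _ fun m _ => (hφm m).comp (hmark m)).add_const b
  have hZ0 : ∀ k ω, 0 ≤ Z k ω := fun k ω =>
    add_nonneg (Finset.sum_nonneg fun m _ => hφ0 m _) hb
  have hprob : ∀ k, μ.real {ω | Z k ω ≤ ‖H n₀ ω‖ ^ 2} =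
      Real.exp (-b) * ∏ m ∈ Finset.range k, if m = n₀ then 1 else v m := by
    intro k
    set s := (Finset.range k).erase n₀ with hs
    have hind : IndepFun (Z k) (fun ω => ‖H n₀ ω‖ ^ 2) μ := by
      have h1 := (h.marks_indep.comp
        (fun m p => if m = n₀ then ‖p.2‖ ^ 2 else φ m p)
        (fun m => by split_ifs; exacts [by fun_prop, hφm m])).indepFun_finsetSum_of_notMem
        (fun m => by
          refine Measurable.comp ?_ (hmark m)
          split_ifs
          exacts [by fun_prop, hφm m]) (s := s) (i := n₀) (by simp [hs])
      have h2 := h1.comp (measurable_id.add_const b) measurable_id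
      convert h2 using 1
      · ext ω
        simp only [hZ, Function.comp_apply, Finset.sum_apply, id_eq]
        congr 1
        refine Finset.sum_congr rfl fun m hm => ?_
        rw [if_neg (Finset.ne_of_mem_erase hm)]
      · ext ω
        simp
    rw [measureReal_le_fading (h.measurable_fading n₀) (h.fading_law n₀) (hZm k) (hZ0 k) hind]
    have hsplit : ∀ ω, Real.exp (-Z k ω) =
        Real.exp (-b) * ∏ m : s, Real.exp (-φ m (K m ω, H m ω)) := by
      intro ω
      rw [← Real.exp_sum, ← Real.exp_add, Finset.sum_neg_distrib,
        Finset.sum_coe_sort s fun m => φ m (K m ω, H m ω)]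
      simp only [hZ, hs]
      ring_nf
    simp_rw [hsplit]
    rw [integral_const_mul]
    congr 1
    have hind' := (h.marks_indep.precomp (g := fun m : s => (m : ℕ))
      Subtype.val_injective).comp (fun m p => Real.exp (-φ m p))
      (fun m => (hφm m).neg.exp)
    have := hind'.integral_fun_prod_eq_prod_integral fun m =>
      ((hφm m).neg.exp.comp (hmark m)).aestronglyMeasurable
    simp only [Function.comp_apply] at this
    rw [this]
    have hval : ∀ m : ℕ, ∫ ω, Real.exp (-φ m (K m ω, H m ω)) ∂μ = v m := fun m =>
      h.integral_exp_neg_mark m (A m) (hd m)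
    simp_rw [hval]
    rw [Finset.prod_coe_sort s v]
    by_cases hn : n₀ ∈ Finset.range k
    · rw [← Finset.mul_prod_erase _ _ hn, if_pos rfl, one_mul]
      exact Finset.prod_congr rfl fun m hm => (if_neg (Finset.ne_of_mem_erase hm)).symm
    · rw [hs, Finset.erase_eq_of_notMem hn]
      refine Finset.prod_congr rfl fun m hm => (if_neg ?_).symm
      rintro rfl
      exact hn hm
  have hv01 : ∀ m, 0 ≤ v m ∧ v m ≤ 1 := by
    intro m
    have h1 : d m / (1 + d m) ≤ 1 := div_le_one_of_le₀ (by linarith [hd m]) (by linarith [hd m])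
    have h2 : 0 ≤ d m / (1 + d m) := div_nonneg (hd m) (by linarith [hd m])
    have h3 := h.sum_alpha_nonneg (A m)
    have h4 := h.sum_alpha_le_one (A m)
    exact ⟨sub_nonneg.2 (mul_le_one₀ h4 h2 h1), sub_le_self _ (mul_nonneg h3 h2)⟩
  have hset : {ω | ∀ k, ∑ m ∈ (Finset.range k).erase n₀,
      (if K m ω ∈ A m then d m * ‖H m ω‖ ^ 2 else 0) + b ≤ ‖H n₀ ω‖ ^ 2} =
      ⋂ k, {ω | Z k ω ≤ ‖H n₀ ω‖ ^ 2} := by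
    ext ω
    simp [hZ, hφ]
  have hH := h.measurable_fading n₀
  have hanti : Antitone fun k => {ω | Z k ω ≤ ‖H n₀ ω‖ ^ 2} := by
    intro k k' hkk' ω hω
    refine le_trans ?_ (show Z k' ω ≤ _ from hω)
    simp only [hZ]
    gcongr
    exact fun m _ _ => hφ0 m _
  have hlim := tendsto_measure_iInter_atTop (μ := μ) (s := fun k => {ω | Z k ω ≤ ‖H n₀ ω‖ ^ 2})
    (fun k => (measurableSet_le (hZm k) (by fun_prop)).nullMeasurableSet) hanti
    ⟨0, measure_ne_top _ _⟩
  have hlim' := (ENNReal.tendsto_toReal (measure_ne_top μ _)).comp hlim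
  rw [hset]
  refine tendsto_nhds_unique hlim' ?_
  have := (tendsto_infProd (a := fun m => if m = n₀ then 1 else v m)
    (fun m => by split_ifs; exacts [zero_le_one, (hv01 m).1])
    (fun m => by split_ifs; exacts [le_rfl, (hv01 m).2])).const_mul (Real.exp (-b))
  refine this.congr fun k => ?_
  rw [← hprob k]
  rfl

end IsDownlinkModel

/-! ### The nearest point of a configuration -/

/-- The serving index as a function of the configuration of locations; for a process `X` it is
`servingIndex X` by definition. -/
noncomputable def nearest (x : ℕ → Plane) : ℕ := sInf {n | ∀ m, ‖x n‖ ≤ ‖x m‖}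

theorem nearest_spec {x : ℕ → Plane} (hx : ∀ ρ : ℕ, {n | ‖x n‖ ≤ ρ}.Finite) (m : ℕ) :
    ‖x (nearest x)‖ ≤ ‖x m‖ := by
  have hne : {n | ∀ m, ‖x n‖ ≤ ‖x m‖}.Nonempty := by
    have h0 : (0 : ℕ) ∈ {n | ‖x n‖ ≤ (⌈‖x 0‖⌉₊ : ℕ)} :=
      show ‖x 0‖ ≤ _ from Nat.le_ceil _
    obtain ⟨n, hn, hmin⟩ := Set.exists_min_image _ (fun n => ‖x n‖) (hx ⌈‖x 0‖⌉₊) ⟨0, h0⟩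
    refine ⟨n, fun m => ?_⟩
    by_cases hm : m ∈ {n | ‖x n‖ ≤ (⌈‖x 0‖⌉₊ : ℕ)}
    · exact hmin m hm
    · exact (show ‖x n‖ ≤ _ from hn).trans (not_le.1 hm).le
  exact Nat.sInf_mem hne m

theorem measurable_sInf_nat : Measurable (sInf : Set ℕ → ℕ) := by
  refine measurable_to_countable' fun n => ?_
  have hset : (sInf : Set ℕ → ℕ) ⁻¹' {n} =
      ({s | n ∈ s} ∩ ⋂ m, ⋂ (_ : m < n), {s : Set ℕ | m ∉ s}) ∪
        ({_s | n = 0} ∩ ⋂ m, {s : Set ℕ | m ∉ s}) := by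
    ext s
    simp only [Set.mem_preimage, Set.mem_singleton_iff, Set.mem_union, Set.mem_inter_iff,
      Set.mem_ofPred_eq, Set.mem_iInter]
    constructor
    · rintro rfl
      rcases s.eq_empty_or_nonempty with rfl | hs
      · exact Or.inr ⟨Nat.sInf_empty, fun m => Set.notMem_empty m⟩
      · exact Or.inl ⟨Nat.sInf_mem hs, fun m hm => Nat.notMem_of_lt_sInf hm⟩
    · rintro (⟨hn, hlt⟩ | ⟨rfl, h⟩)
      · refine le_antisymm (Nat.sInf_le hn) (not_lt.1 fun hlt' => ?_)
        exact hlt _ hlt' (Nat.sInf_mem ⟨n, hn⟩)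
      · rw [Set.eq_empty_of_forall_notMem h, Nat.sInf_empty]
  have hmem : ∀ m, MeasurableSet {s : Set ℕ | m ∈ s} := fun m =>
    measurableSet_setOfPred.2 (measurable_set_mem m)
  rw [hset]
  refine ((hmem n).inter (MeasurableSet.iInter fun m => MeasurableSet.iInter fun _ =>
    (hmem m).compl)).union ((MeasurableSet.const _).inter (MeasurableSet.iInter fun m =>
    (hmem m).compl))

theorem measurable_nearest : Measurable nearest := by
  have hset : Measurable fun x : ℕ → Plane => {n | ∀ m, ‖x n‖ ≤ ‖x m‖} := by
    refine measurable_set_iff.2 fun n => measurableSet_setOfPred.1 ?_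
    have h : MeasurableSet (⋂ m, {x : ℕ → Plane | ‖x n‖ ≤ ‖x m‖}) :=
      MeasurableSet.iInter fun m => measurableSet_le (by fun_prop) (by fun_prop)
    convert h
    simp [Set.ext_iff]
  exact measurable_sInf_nat.comp hset

theorem measurable_norm_nearest : Measurable fun x : ℕ → Plane => ‖x (nearest x)‖ := by
  intro s hs
  have hset : (fun x : ℕ → Plane => ‖x (nearest x)‖) ⁻¹' s =
      ⋃ n, nearest ⁻¹' {n} ∩ (fun x : ℕ → Plane => ‖x n‖) ⁻¹' s := by
    ext x
    simp
  rw [hset]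
  refine MeasurableSet.iUnion fun n => (measurable_nearest (MeasurableSet.singleton n)).inter ?_
  exact (measurable_pi_apply n).norm hs

/-! ### Success as an event in the marks, given the locations -/

variable {N M : ℕ}

/-- The packets whose transmission by a base station at `y` is not cancelled by a user of the
`i`-th subset. -/
noncomputable def uncancelled (C : CachingScheme N M) (S : RadioSystem) (i : Fin (N.choose M))
    (y : Plane) : Finset (Fin N) :=
  if S.Rb ≤ ‖y‖ then Finset.univ else (C.cache i)ᶜ

/-- The mean power, in units of the serving power divided by `T̄`, of an interferer at `y` when
the serving distance is `r`. -/
noncomputable def relPower (S : RadioSystem) (r : ℝ) (y : Plane) : ℝ :=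
  S.Tbar * r ^ S.β * ‖y‖ ^ (-S.β)

/-- The noise power, in the same unit. -/
noncomputable def relNoise (S : RadioSystem) (r : ℝ) : ℝ := r ^ S.β * S.P⁻¹ * S.Tbar * S.noise

/-- The factor by which an interferer at `y` reduces the success probability when the serving
distance is `r`. -/
noncomputable def survival (C : CachingScheme N M) (S : RadioSystem) (i : Fin (N.choose M))
    (r : ℝ) (y : Plane) : ℝ :=
  1 - (∑ j ∈ uncancelled C S i y, C.alpha j) * S.damping r ‖y‖

/-- The pairs of a configuration of locations and a configuration of marks for which every partial
sum of the interference is small enough for a success. In this form the event is measurable without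
any convergence of the interference. -/
def successSet (C : CachingScheme N M) (S : RadioSystem) (i : Fin (N.choose M)) :
    Set ((ℕ → Plane) × (ℕ → Fin N × ℂ)) :=
  {p | ∀ k, ∑ m ∈ (Finset.range k).erase (nearest p.1),
      (if (p.2 m).1 ∈ uncancelled C S i (p.1 m) then
        relPower S ‖p.1 (nearest p.1)‖ (p.1 m) * ‖(p.2 m).2‖ ^ 2 else 0) +
      relNoise S ‖p.1 (nearest p.1)‖ ≤ ‖(p.2 (nearest p.1)).2‖ ^ 2}

theorem relPower_nonneg (S : RadioSystem) {r : ℝ} (hr : 0 ≤ r) (y : Plane) :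
    0 ≤ relPower S r y := by
  have := S.Tbar_pos
  unfold relPower
  positivity

theorem relNoise_nonneg (S : RadioSystem) {r : ℝ} (hr : 0 ≤ r) : 0 ≤ relNoise S r := by
  have := S.Tbar_pos
  have := S.P_pos
  have := S.noise_nonneg
  unfold relNoise
  positivity

theorem measurableSet_mem_uncancelled (C : CachingScheme N M) (S : RadioSystem)
    (i : Fin (N.choose M)) (j : Fin N) : MeasurableSet {y | j ∈ uncancelled C S i y} := by
  have : {y | j ∈ uncancelled C S i y} = {y | S.Rb ≤ ‖y‖} ∪ {_y | j ∉ C.cache i} := by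
    ext y
    simp only [uncancelled, Set.mem_ofPred_eq, Set.mem_union]
    split_ifs with h <;> simp [h]
  rw [this]
  exact (measurableSet_le measurable_const measurable_norm).union (MeasurableSet.const _)

theorem measurableSet_successSet (C : CachingScheme N M) (S : RadioSystem) (i : Fin (N.choose M)) :
    MeasurableSet (successSet C S i) := by
  have hmem : ∀ m, MeasurableSet {p : (ℕ → Plane) × (ℕ → Fin N × ℂ) |
      (p.2 m).1 ∈ uncancelled C S i (p.1 m)} := by
    intro m
    have : {p : (ℕ → Plane) × (ℕ → Fin N × ℂ) | (p.2 m).1 ∈ uncancelled C S i (p.1 m)} =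
        ⋃ j, {p | (p.2 m).1 = j} ∩ {p | j ∈ uncancelled C S i (p.1 m)} := by
      ext p
      simp
    rw [this]
    refine MeasurableSet.iUnion fun j => MeasurableSet.inter ?_ ?_
    · have h : Measurable fun p : (ℕ → Plane) × (ℕ → Fin N × ℂ) => (p.2 m).1 := by fun_prop
      exact h (MeasurableSet.singleton j)
    · have h : Measurable fun p : (ℕ → Plane) × (ℕ → Fin N × ℂ) => p.1 m := by fun_prop
      exact h (measurableSet_mem_uncancelled C S i j)
  have hnear : Measurable fun p : (ℕ → Plane) × (ℕ → Fin N × ℂ) => nearest p.1 :=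
    measurable_nearest.comp measurable_fst
  have : successSet C S i = ⋃ n, {p | nearest p.1 = n} ∩ ⋂ k,
      {p | ∑ m ∈ (Finset.range k).erase n, (if (p.2 m).1 ∈ uncancelled C S i (p.1 m) then
        relPower S ‖p.1 n‖ (p.1 m) * ‖(p.2 m).2‖ ^ 2 else 0) + relNoise S ‖p.1 n‖ ≤
          ‖(p.2 n).2‖ ^ 2} := by
    ext p
    simp [successSet]
  rw [this]
  refine MeasurableSet.iUnion fun n => (hnear (MeasurableSet.singleton n)).inter
    (MeasurableSet.iInter fun k => measurableSet_le ?_ (by fun_prop))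
  refine (Finset.measurable_fun_sum _ fun m _ => ?_).add ?_
  · refine Measurable.ite (hmem m) ?_ measurable_const
    unfold relPower
    fun_prop
  · unfold relNoise
    fun_prop

theorem measurable_survival (C : CachingScheme N M) (S : RadioSystem) (i : Fin (N.choose M))
    (r : ℝ) : Measurable (survival C S i r) := by
  have h : survival C S i r = fun y => 1 -
      (if S.Rb ≤ ‖y‖ then ∑ j, C.alpha j else ∑ j ∈ (C.cache i)ᶜ, C.alpha j) *
        S.damping r ‖y‖ := by
    ext y
    rw [survival, uncancelled]
    split_ifs <;> rfl
  rw [h]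
  refine measurable_const.sub (Measurable.mul ?_ (by fun_prop))
  exact Measurable.ite (measurableSet_le measurable_const measurable_norm) measurable_const
    measurable_const

/-- For a regular configuration the signal-to-interference-plus-noise ratio is the quotient that
it is meant to be: the interference converges and is positive. -/
theorem Tbar_le_sinr_iff {Ω : Type*} (C : CachingScheme N M) (S : RadioSystem)
    (i : Fin (N.choose M)) (X : ℕ → Ω → Plane) (K : ℕ → Ω → Fin N) (H : ℕ → Ω → ℂ) (ω : Ω)
    (hfin : ∀ ρ : ℕ, {n | ‖X n ω‖ ≤ ρ}.Finite) (hX : ∀ n, X n ω ≠ 0) (hH : ∀ n, H n ω ≠ 0)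
    (hsum : ∀ k : ℕ, Summable fun n =>
      (Set.Ioi (1 / ((k : ℝ) + 1))).indicator (fun d => d ^ (-S.β)) ‖X n ω‖ * ‖H n ω‖ ^ 2) :
    S.Tbar ≤ sinr C S X K H i ω ↔
      ((fun n => X n ω), fun n => (K n ω, H n ω)) ∈ successSet C S i := by
  have hT := S.Tbar_pos
  have hP := S.P_pos
  set n₀ := servingIndex X ω with hn₀
  have hnear : nearest (fun n => X n ω) = n₀ := rfl
  set r := ‖X n₀ ω‖ with hr
  have hr0 : 0 < r := norm_pos_iff.2 (hX n₀)
  have hle : ∀ m, r ≤ ‖X m ω‖ := fun m => nearest_spec hfin m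
  have hdist : servingDist X ω = r := rfl
  have hrx0 : ∀ n, 0 ≤ rxPower S X H n ω := fun n => by unfold rxPower; positivity
  -- the two kinds of interference together
  set t : ℕ → ℝ := fun n => if n ≠ n₀ ∧ K n ω ∈ uncancelled C S i (X n ω)
    then rxPower S X H n ω else 0 with ht
  set u : ℕ → ℝ := fun n => if n ≠ servingIndex X ω ∧ K n ω ∈ C.cache i ∧
    max (servingDist X ω) S.Rb ≤ ‖X n ω‖ then rxPower S X H n ω else 0 with hu
  set w : ℕ → ℝ := fun n => if n ≠ servingIndex X ω ∧ K n ω ∉ C.cache i ∧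
    servingDist X ω ≤ ‖X n ω‖ then rxPower S X H n ω else 0 with hw
  have huw : ∀ n, u n + w n = t n := by
    intro n
    simp only [hu, hw, ht, hdist, uncancelled, max_le_iff, hle n, true_and, and_true, ← hn₀]
    by_cases h1 : n = n₀ <;> by_cases h2 : K n ω ∈ C.cache i <;>
      by_cases h3 : S.Rb ≤ ‖X n ω‖ <;> simp [h1, h2, h3]
  obtain ⟨k₀, hk₀⟩ := exists_nat_one_div_lt hr0
  have hrxs : Summable fun n => rxPower S X H n ω := by
    refine ((hsum k₀).mul_left S.P).congr fun n => ?_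
    rw [Set.indicator_of_mem (Set.mem_Ioi.2 (hk₀.trans_le (hle n))), rxPower]
    ring
  have hus : Summable u := hrxs.of_nonneg_of_le
    (fun n => by simp only [hu]; split_ifs; exacts [hrx0 n, le_rfl])
    (fun n => by simp only [hu]; split_ifs; exacts [le_rfl, hrx0 n])
  have hws : Summable w := hrxs.of_nonneg_of_le
    (fun n => by simp only [hw]; split_ifs; exacts [hrx0 n, le_rfl])
    (fun n => by simp only [hw]; split_ifs; exacts [le_rfl, hrx0 n])
  have hts : Summable t := (hus.add hws).congr fun n => huw n
  have ht0 : ∀ n, 0 ≤ t n := fun n => by simp only [ht]; split_ifs; exacts [hrx0 n, le_rfl]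
  have hI : cachedInterference C S X K H i ω + uncachedInterference C S X K H i ω = ∑' n, t n := by
    calc _ = ∑' n, u n + ∑' n, w n := by
          simp only [cachedInterference, uncachedInterference, hu, hw]
      _ = ∑' n, t n := by
          rw [← hus.tsum_add hws]
          exact tsum_congr huw
  -- a far interferer is never cancelled
  have hpos : 0 < ∑' n, t n := by
    obtain ⟨n, hn⟩ := ((hfin ⌈S.Rb⌉₊).union (Set.finite_singleton n₀)).exists_notMem
    simp only [Set.mem_union, Set.mem_ofPred_eq, Set.mem_singleton_iff, not_or, not_le] at hn
    have hRb : S.Rb ≤ ‖X n ω‖ := (Nat.le_ceil _).trans hn.1.le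
    refine hts.tsum_pos ht0 n ?_
    have h1 : 0 < ‖H n ω‖ := norm_pos_iff.2 (hH n)
    have h2 : 0 < ‖X n ω‖ := norm_pos_iff.2 (hX n)
    simp only [ht]
    rw [if_pos ⟨hn.2, by simp [uncancelled, hRb]⟩, rxPower]
    positivity
  have hden : 0 < ∑' n, t n + S.noise := add_pos_of_pos_of_nonneg hpos S.noise_nonneg
  set a := S.Tbar * r ^ S.β * S.P⁻¹ with ha
  have ha0 : 0 < a := by positivity
  have hnoise : relNoise S r = a * S.noise := by rw [relNoise, ha]; ring
  have hserve : rxPower S X H n₀ ω * (r ^ S.β * S.P⁻¹) = ‖H n₀ ω‖ ^ 2 := by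
    rw [rxPower, ← hr, Real.rpow_neg hr0.le]
    have : r ^ S.β ≠ 0 := by positivity
    field_simp
  have hc : 0 < r ^ S.β * S.P⁻¹ := by positivity
  have h1 : S.Tbar ≤ sinr C S X K H i ω ↔ a * ∑' n, t n + relNoise S r ≤ ‖H n₀ ω‖ ^ 2 := by
    rw [sinr, hI, le_div_iff₀ hden, ← hn₀, ← mul_le_mul_iff_left₀ hc, hserve, hnoise]
    apply iff_of_eq
    congr 1
    rw [ha]
    ring
  have hpart : ∀ k, ∑ m ∈ (Finset.range k).erase n₀,
      (if K m ω ∈ uncancelled C S i (X m ω) then relPower S r (X m ω) * ‖H m ω‖ ^ 2 else 0) =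
      a * ∑ m ∈ Finset.range k, t m := by
    intro k
    have h2 : ∑ m ∈ Finset.range k, t m = ∑ m ∈ (Finset.range k).erase n₀, t m := by
      refine (Finset.sum_erase _ ?_).symm
      simp [ht]
    rw [h2, Finset.mul_sum]
    refine Finset.sum_congr rfl fun m hm => ?_
    have hne := Finset.ne_of_mem_erase hm
    simp only [ht, hne, ne_eq, not_false_eq_true, true_and]
    split_ifs
    · rw [relPower, rxPower, ha]
      field_simp
    · simp
  rw [h1, successSet]
  simp only [Set.mem_ofPred_eq, hnear, ← hr, hpart]
  constructor
  · intro h k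
    refine le_trans ?_ h
    gcongr
    exact hts.sum_le_tsum _ fun m _ => ht0 m
  · intro h
    have : a * ∑' n, t n ≤ ‖H n₀ ω‖ ^ 2 - relNoise S r := by
      rw [← tsum_mul_left]
      refine Real.tsum_le_of_sum_range_le (fun n => mul_nonneg ha0.le (ht0 n)) fun k => ?_
      rw [← Finset.mul_sum]
      linarith [h k]
    linarith

/-! ### Regular configurations, and conditioning on the locations -/

theorem integrable_and_measureReal_pair_mem {Ω : Type*} [MeasurableSpace Ω] {μ : Measure Ω}
    [IsProbabilityMeasure μ] {α β : Type*} [MeasurableSpace α] [MeasurableSpace β]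
    {f : Ω → α} {g : Ω → β} (hf : Measurable f) (hg : Measurable g) (h : IndepFun f g μ)
    {s : Set (α × β)} (hs : MeasurableSet s) :
    Integrable (fun ω => μ.real {ω' | (f ω, g ω') ∈ s}) μ ∧
      μ.real {ω | (f ω, g ω) ∈ s} = ∫ ω, μ.real {ω' | (f ω, g ω') ∈ s} ∂μ := by
  have hprob : IsProbabilityMeasure (μ.map g) := Measure.isProbabilityMeasure_map hg.aemeasurable
  have hm : Measurable fun ω => μ {ω' | (f ω, g ω') ∈ s} := by
    have heq : (fun ω => μ {ω' | (f ω, g ω') ∈ s}) = fun ω => μ.map g (Prod.mk (f ω) ⁻¹' s) :=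
      funext fun ω => (Measure.map_apply hg (measurable_prodMk_left hs)).symm
    rw [heq]
    exact (measurable_measure_prodMk_left hs).comp hf
  constructor
  · refine Integrable.of_bound hm.ennreal_toReal.aestronglyMeasurable 1
      (Eventually.of_forall fun ω => ?_)
    rw [Real.norm_of_nonneg measureReal_nonneg]
    exact measureReal_le_one
  · rw [measureReal_def, measure_pair_mem_eq_lintegral hf hg h hs,
      integral_eq_lintegral_of_nonneg_ae (Eventually.of_forall fun ω => measureReal_nonneg)
        hm.ennreal_toReal.aestronglyMeasurable]
    congr 1
    refine lintegral_congr fun ω => ?_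
    rw [ofReal_measureReal]

namespace IsDownlinkModel

variable {Ω : Type*} [MeasurableSpace Ω] {N M : ℕ} {C : CachingScheme N M} {S : RadioSystem}
  {μ : Measure Ω} {X : ℕ → Ω → Plane} {K : ℕ → Ω → Fin N}
  {H : ℕ → Ω → ℂ}

theorem ae_fading_ne_zero (h : IsDownlinkModel C S μ X K H) : ∀ᵐ ω ∂μ, ∀ n, H n ω ≠ 0 := by
  refine ae_all_iff.2 fun n => ?_
  have h0 : rayleighMeasure 1 {0} = 0 := by
    rw [rayleighMeasure]
    exact withDensity_absolutelyContinuous _ _ (by simp)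
  rw [← h.fading_law n, Measure.map_apply (h.measurable_fading n).norm
    (MeasurableSet.singleton 0)] at h0
  refine measure_mono_null (fun ω hω => ?_) h0
  have : H n ω = 0 := by simpa using hω
  simp [this]

theorem ae_location_ne_zero [IsProbabilityMeasure μ] (h : IsDownlinkModel C S μ X K H) : ∀ᵐ ω ∂μ, ∀ n, X n ω ≠ 0 := by
  refine ae_all_iff.2 fun n => ?_
  have h0 : Measure.sum (fun n => μ.map (X n)) {0} = 0 := by
    rw [h.poisson.sum_map_apply (MeasurableSet.singleton 0) (by simp)]
    simp
  rw [Measure.sum_apply_eq_zero' (MeasurableSet.singleton 0)] at h0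
  have h1 := h0 n
  rw [Measure.map_apply (h.poisson.measurable n) (MeasurableSet.singleton 0)] at h1
  refine measure_mono_null (fun ω hω => ?_) h1
  have : X n ω = 0 := by simpa using hω
  simp [this]

theorem ae_finite_ball [IsProbabilityMeasure μ] (h : IsDownlinkModel C S μ X K H) :
    ∀ᵐ ω ∂μ, ∀ ρ : ℕ, {n | ‖X n ω‖ ≤ ρ}.Finite := by
  refine ae_all_iff.2 fun ρ => ?_
  have := h.poisson.finite_points (A := Metric.closedBall 0 ρ) measurableSet_closedBall
    (by simp [Measure.smul_apply, ENNReal.mul_eq_top])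
  simpa [Metric.mem_closedBall, dist_zero_right] using this

/-- The interference from beyond any positive distance has finite mean, because the path-loss
exponent exceeds the dimension. -/
theorem ae_summable [IsProbabilityMeasure μ] (h : IsDownlinkModel C S μ X K H) {ρ : ℝ} (hρ : 0 < ρ) :
    ∀ᵐ ω ∂μ, Summable fun n =>
      (Set.Ioi ρ).indicator (fun d => d ^ (-S.β)) ‖X n ω‖ * ‖H n ω‖ ^ 2 := by
  have hf0 : ∀ y : Plane, 0 ≤ (Set.Ioi ρ).indicator (fun d => d ^ (-S.β)) ‖y‖ := fun y =>
    Set.indicator_nonneg (fun d hd => Real.rpow_nonneg (hρ.trans hd).le _) _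
  have hfm : Measurable fun y : Plane => (Set.Ioi ρ).indicator (fun d => d ^ (-S.β)) ‖y‖ :=
    ((by fun_prop : Measurable fun d : ℝ => d ^ (-S.β)).indicator measurableSet_Ioi).comp
      measurable_norm
  have hXm := h.poisson.measurable
  have hHm := h.measurable_fading
  set W := ∫⁻ x, ENNReal.ofReal (x ^ 2) ∂rayleighMeasure 1 with hW
  have hmean : ∀ n, ∫⁻ ω, ENNReal.ofReal
      ((Set.Ioi ρ).indicator (fun d => d ^ (-S.β)) ‖X n ω‖ * ‖H n ω‖ ^ 2) ∂μ =
      (∫⁻ y, ENNReal.ofReal ((Set.Ioi ρ).indicator (fun d => d ^ (-S.β)) ‖y‖) ∂μ.map (X n)) *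
        W := by
    intro n
    have hind := h.location_indep_marks.comp
      (φ := fun x => ENNReal.ofReal ((Set.Ioi ρ).indicator (fun d => d ^ (-S.β)) ‖x n‖))
      (ψ := fun y : ℕ → Fin N × ℂ => ENNReal.ofReal (‖(y n).2‖ ^ 2))
      (Measurable.ennreal_ofReal (hfm.comp (g := fun y : Plane =>
        (Set.Ioi ρ).indicator (fun d => d ^ (-S.β)) ‖y‖) (f := fun x : ℕ → Plane => x n)
        (measurable_pi_apply n))) (by fun_prop)
    have := lintegral_mul_eq_lintegral_mul_lintegral_of_indepFun
      (hfm.comp (hXm n)).ennreal_ofReal ((hHm n).norm.pow_const 2).ennreal_ofReal hind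
    rw [lintegral_map hfm.ennreal_ofReal (hXm n), hW, ← h.fading_law n,
      lintegral_map (by fun_prop) (hHm n).norm]
    refine Eq.trans (lintegral_congr fun ω => ?_) this
    rw [Pi.mul_apply, ENNReal.ofReal_mul (hf0 _)]
    rfl
  have hterm : ∀ n, Measurable fun ω => ENNReal.ofReal
      ((Set.Ioi ρ).indicator (fun d => d ^ (-S.β)) ‖X n ω‖ * ‖H n ω‖ ^ 2) := fun n =>
    ((hfm.comp (hXm n)).mul ((hHm n).norm.pow_const 2)).ennreal_ofReal
  have hfin : ∫⁻ ω, ∑' n, ENNReal.ofReal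
      ((Set.Ioi ρ).indicator (fun d => d ^ (-S.β)) ‖X n ω‖ * ‖H n ω‖ ^ 2) ∂μ ≠ ∞ := by
    rw [lintegral_tsum fun n => (hterm n).aemeasurable]
    simp_rw [hmean]
    have : SigmaFinite (ENNReal.ofReal S.lam • (volume : Measure Plane)) :=
      inferInstanceAs (SigmaFinite (S.lam.toNNReal • (volume : Measure Plane)))
    rw [ENNReal.tsum_mul_right, ← lintegral_sum_measure, h.poisson.sum_map_eq,
      lintegral_smul_measure]
    refine ENNReal.mul_ne_top (ENNReal.mul_ne_top ENNReal.ofReal_ne_top ?_)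
      lintegral_sq_rayleighMeasure_one_lt_top.ne
    exact (Integrable.lintegral_lt_top (integrable_rpow_norm_of_lt S.two_lt_β hρ)).ne
  have hae := ae_lt_top (Measurable.tsum fun n => hterm n) hfin
  filter_upwards [hae] with ω hω
  refine (ENNReal.summable_toReal hω.ne).congr fun n => ?_
  exact ENNReal.toReal_ofReal (mul_nonneg (hf0 _) (by positivity))

theorem ae_Tbar_le_sinr_iff [IsProbabilityMeasure μ] (h : IsDownlinkModel C S μ X K H) (i : Fin (N.choose M)) :
    ∀ᵐ ω ∂μ, S.Tbar ≤ sinr C S X K H i ω ↔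
      ((fun n => X n ω), fun n => (K n ω, H n ω)) ∈ successSet C S i := by
  filter_upwards [h.ae_finite_ball, h.ae_location_ne_zero, h.ae_fading_ne_zero,
    ae_all_iff.2 fun k : ℕ => h.ae_summable (ρ := 1 / ((k : ℝ) + 1)) (by positivity)]
    with ω h1 h2 h3 h4
  exact Tbar_le_sinr_iff C S i X K H ω h1 h2 h3 h4

theorem measurable_locations (h : IsDownlinkModel C S μ X K H) :
    Measurable fun ω n => X n ω :=
  measurable_pi_lambda _ h.poisson.measurable

theorem measurable_marks (h : IsDownlinkModel C S μ X K H) :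
    Measurable fun ω n => (K n ω, H n ω) :=
  measurable_pi_lambda _ fun n => (h.measurable_packet n).prodMk (h.measurable_fading n)

theorem measurable_servingDist (h : IsDownlinkModel C S μ X K H) : Measurable (servingDist X) := by
  have hcomp : servingDist X = (fun x : ℕ → Plane => ‖x (nearest x)‖) ∘ fun ω n => X n ω := by
    ext ω
    rfl
  rw [hcomp]
  exact Measurable.comp measurable_norm_nearest h.measurable_locations

theorem nullMeasurableSet_success [IsProbabilityMeasure μ] (h : IsDownlinkModel C S μ X K H) (i : Fin (N.choose M)) :
    NullMeasurableSet {ω | S.Tbar ≤ sinr C S X K H i ω} μ := by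
  have hm : MeasurableSet {ω | ((fun n => X n ω), fun n => (K n ω, H n ω)) ∈ successSet C S i} :=
    (h.measurable_locations.prodMk h.measurable_marks) (measurableSet_successSet C S i)
  refine hm.nullMeasurableSet.congr ?_
  filter_upwards [h.ae_Tbar_le_sinr_iff i] with ω hω
  exact propext hω.symm

/-- The probability of a success with serving distance in `(s, t]`, conditioned on the
locations. -/
theorem measureReal_success_Ioc [IsProbabilityMeasure μ] (h : IsDownlinkModel C S μ X K H) (i : Fin (N.choose M))
    (s t : ℝ) :
    let F := fun ω => if s < servingDist X ω ∧ servingDist X ω ≤ t then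
      Real.exp (-relNoise S (servingDist X ω)) * infProd (fun m =>
        if m = servingIndex X ω then 1 else survival C S i (servingDist X ω) (X m ω)) else 0
    Integrable F μ ∧
      μ.real {ω | S.Tbar ≤ sinr C S X K H i ω ∧ s < servingDist X ω ∧ servingDist X ω ≤ t} =
        ∫ ω, F ω ∂μ := by
  intro F
  set E : Set ((ℕ → Plane) × (ℕ → Fin N × ℂ)) :=
    {p | s < ‖p.1 (nearest p.1)‖} ∩ {p | ‖p.1 (nearest p.1)‖ ≤ t} ∩ successSet C S i with hE
  have hdm : Measurable fun p : (ℕ → Plane) × (ℕ → Fin N × ℂ) => ‖p.1 (nearest p.1)‖ :=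
    measurable_norm_nearest.comp measurable_fst
  have hEm : MeasurableSet E := ((measurableSet_lt measurable_const hdm).inter
    (measurableSet_le hdm measurable_const)).inter (measurableSet_successSet C S i)
  have hF : F = fun ω => μ.real {ω' | ((fun n => X n ω), fun n => (K n ω', H n ω')) ∈ E} := by
    ext ω
    by_cases hR : s < servingDist X ω ∧ servingDist X ω ≤ t
    · have hset : {ω' | ((fun n => X n ω), fun n => (K n ω', H n ω')) ∈ E} =
          {ω' | ∀ k, ∑ m ∈ (Finset.range k).erase (servingIndex X ω),
            (if K m ω' ∈ uncancelled C S i (X m ω) then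
              relPower S (servingDist X ω) (X m ω) * ‖H m ω'‖ ^ 2 else 0) +
              relNoise S (servingDist X ω) ≤ ‖H (servingIndex X ω) ω'‖ ^ 2} := by
        ext ω'
        exact ⟨fun hω => hω.2, fun hω => ⟨hR, hω⟩⟩
      have hr : 0 ≤ servingDist X ω := norm_nonneg _
      rw [hset, h.measureReal_forall_partial_sum_le _ _ (fun m => relPower_nonneg S hr _)
        (relNoise_nonneg S hr)]
      exact if_pos hR
    · have hset : {ω' | ((fun n => X n ω), fun n => (K n ω', H n ω')) ∈ E} = ∅ := by
        ext ω'
        exact ⟨fun hω => hR hω.1, fun hω => hω.elim⟩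
      rw [hset, measureReal_empty]
      exact if_neg hR
  have key := integrable_and_measureReal_pair_mem h.measurable_locations h.measurable_marks
    h.location_indep_marks hEm
  rw [hF]
  refine ⟨key.1, ?_⟩
  rw [← key.2]
  refine measureReal_congr ?_
  filter_upwards [h.ae_Tbar_le_sinr_iff i] with ω hω
  refine propext ⟨fun h' => ⟨h'.2, hω.1 h'.1⟩, fun h' => ⟨hω.2 h'.2, h'.1⟩⟩

end IsDownlinkModel

/-! ### Bounds for the probability of a success with serving distance in an interval -/

section Shell

variable {N M : ℕ}

/-- The function with value `0` up to distance `s`, value `θ` in the shell from `s` to `t`, and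
value `survival C S i r` beyond `t`. -/
noncomputable def shell (C : CachingScheme N M) (S : RadioSystem) (i : Fin (N.choose M))
    (s t θ r : ℝ) (y : Plane) : ℝ :=
  if ‖y‖ ≤ s then 0 else if ‖y‖ ≤ t then θ else survival C S i r y

/-- Mean effect of the interference from beyond `t` on a user served from distance `r`. -/
noncomputable def interferenceExponent (C : CachingScheme N M) (S : RadioSystem)
    (i : Fin (N.choose M)) (r t : ℝ) : ℝ :=
  Real.pi * r ^ 2 * (S.lam1 C i * S.Z1 ((r / max t S.Rb) ^ S.β * S.Tbar) +
    S.lam2 C i * S.Z1 ((r / t) ^ S.β * S.Tbar))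

variable {C : CachingScheme N M} {S : RadioSystem} {i : Fin (N.choose M)}

theorem measurable_shell (s t θ r : ℝ) : Measurable (shell C S i s t θ r) := by
  refine Measurable.ite (measurableSet_le measurable_norm measurable_const) measurable_const ?_
  exact Measurable.ite (measurableSet_le measurable_norm measurable_const) measurable_const
    (measurable_survival C S i r)

theorem one_sub_shell_ae_eq {s t : ℝ} (hst : s ≤ t) (θ r : ℝ) :
    (fun y => 1 - shell C S i s t θ r y) =ᵐ[volume] fun y =>
      ((Metric.closedBall 0 s).indicator (fun _ => (1 : ℝ)) y +
        (Metric.closedBall 0 t \ Metric.closedBall 0 s).indicator (fun _ => 1 - θ) y) +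
      ((∑ j ∈ C.cache i, C.alpha j) * (Set.Ioi (max t S.Rb)).indicator (S.damping r) ‖y‖ +
        (∑ j ∈ (C.cache i)ᶜ, C.alpha j) * (Set.Ioi t).indicator (S.damping r) ‖y‖) := by
  classical
  have hsphere : ∀ᵐ y : Plane, y ∉ Metric.sphere (0 : Plane) S.Rb :=
    measure_eq_zero_iff_ae_notMem.1 (Measure.addHaar_sphere _ _ _)
  filter_upwards [hsphere] with y hy
  have hy' : ‖y‖ ≠ S.Rb := by simpa using hy
  have hα := Finset.sum_add_sum_compl (C.cache i) C.alpha
  simp only [shell, survival, uncancelled, Set.indicator_apply, Metric.mem_closedBall,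
    dist_zero_right, Set.mem_sdiff, Set.mem_Ioi, max_lt_iff]
  by_cases h1 : ‖y‖ ≤ s
  · have h2 : ‖y‖ ≤ t := h1.trans hst
    simp [h1, h2, not_lt.2 h2]
  · by_cases h2 : ‖y‖ ≤ t
    · simp [h1, h2, not_lt.2 h2]
    · rcases lt_or_gt_of_ne hy' with h3 | h3
      · simp [h1, h2, not_le.1 h2, not_le.2 h3, not_lt.2 h3.le]
      · simp only [h1, h2, not_le.1 h2, h3, h3.le, if_true, if_false, and_self, ← hα]
        simp
        ring

end Shell

theorem volume_real_closedBall_plane {s : ℝ} (hs : 0 ≤ s) :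
    (volume : Measure Plane).real (Metric.closedBall 0 s) = Real.pi * s ^ 2 := by
  rw [measureReal_def, EuclideanSpace.volume_closedBall_fin_two, ENNReal.toReal_mul,
    ENNReal.toReal_pow, ENNReal.toReal_ofReal hs, ENNReal.toReal_ofReal Real.pi_pos.le, mul_comm]

theorem volume_real_annulus_plane {s t : ℝ} (hs : 0 ≤ s) (hst : s ≤ t) :
    (volume : Measure Plane).real (Metric.closedBall 0 t \ Metric.closedBall 0 s) =
      Real.pi * (t ^ 2 - s ^ 2) := by
  rw [measureReal_sdiff (Metric.closedBall_subset_closedBall hst) measurableSet_closedBall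
    measure_closedBall_lt_top.ne, volume_real_closedBall_plane hs, volume_real_closedBall_plane (hs.trans hst)]
  ring

namespace IsDownlinkModel

variable {Ω : Type*} [MeasurableSpace Ω] {N M : ℕ} {C : CachingScheme N M} {S : RadioSystem}
  {μ : Measure Ω} [IsProbabilityMeasure μ] {X : ℕ → Ω → Plane} {K : ℕ → Ω → Fin N}
  {H : ℕ → Ω → ℂ} {i : Fin (N.choose M)}

theorem survival_nonneg (h : IsDownlinkModel C S μ X K H) {r : ℝ} (hr : 0 ≤ r) (y : Plane) :
    0 ≤ survival C S i r y :=
  sub_nonneg.2 (mul_le_one₀ (h.sum_alpha_le_one _) (RadioSystem.damping_nonneg hr (norm_nonneg y))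
    (RadioSystem.damping_le_one hr (norm_nonneg y)))

theorem survival_le_one (h : IsDownlinkModel C S μ X K H) {r : ℝ} (hr : 0 ≤ r) (y : Plane) :
    survival C S i r y ≤ 1 :=
  sub_le_self _ (mul_nonneg (h.sum_alpha_nonneg _)
    (RadioSystem.damping_nonneg hr (norm_nonneg y)))

theorem survival_anti (h : IsDownlinkModel C S μ X K H) {r r' : ℝ} (hr : 0 ≤ r) (hrr' : r ≤ r')
    (y : Plane) : survival C S i r' y ≤ survival C S i r y :=
  sub_le_sub_left (mul_le_mul_of_nonneg_left
    (RadioSystem.damping_mono hr hrr' (norm_nonneg y)) (h.sum_alpha_nonneg _)) 1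

theorem shell_nonneg (h : IsDownlinkModel C S μ X K H) {s t θ r : ℝ} (hr : 0 ≤ r) (hθ : 0 ≤ θ)
    (y : Plane) : 0 ≤ shell C S i s t θ r y := by
  unfold shell
  split_ifs
  exacts [le_rfl, hθ, h.survival_nonneg hr y]

theorem shell_le_one (h : IsDownlinkModel C S μ X K H) {s t θ r : ℝ} (hr : 0 ≤ r) (hθ : θ ≤ 1)
    (y : Plane) : shell C S i s t θ r y ≤ 1 := by
  unfold shell
  split_ifs
  exacts [zero_le_one, hθ, h.survival_le_one hr y]

theorem lam1_eq (C : CachingScheme N M) (S : RadioSystem) (i : Fin (N.choose M)) :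
    S.lam1 C i = S.lam * ∑ j ∈ C.cache i, C.alpha j := by
  simp [RadioSystem.lam1, CachingScheme.q]

theorem lam2_eq (h : IsDownlinkModel C S μ X K H) (i : Fin (N.choose M)) :
    S.lam2 C i = S.lam * ∑ j ∈ (C.cache i)ᶜ, C.alpha j := by
  have h1 := Finset.sum_add_sum_compl (C.cache i) C.alpha
  rw [h.sum_alpha_univ] at h1
  rw [RadioSystem.lam2, ← h1]
  simp [CachingScheme.q]

/-- The generating functional at `shell`: void up to `s`, thinning in the shell, interference
beyond. -/
theorem integral_infProd_shell (h : IsDownlinkModel C S μ X K H) {s t θ r : ℝ} (hs : 0 ≤ s)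
    (hst : s ≤ t) (ht : 0 < t) (hθ0 : 0 ≤ θ) (hθ1 : θ ≤ 1) (hr : 0 < r) :
    ∫ ω, infProd (fun n => shell C S i s t θ r (X n ω)) ∂μ =
      Real.exp (-(S.lam * Real.pi * (s ^ 2 + (1 - θ) * (t ^ 2 - s ^ 2)) +
        interferenceExponent C S i r t)) := by
  have hmax : 0 < max t S.Rb := lt_max_of_lt_left ht
  have hae := one_sub_shell_ae_eq (C := C) (S := S) (i := i) hst θ r
  have hi1 : Integrable ((Metric.closedBall (0 : Plane) s).indicator fun _ => (1 : ℝ)) :=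
    (integrable_indicator_iff measurableSet_closedBall).2
      (integrableOn_const measure_closedBall_lt_top.ne)
  have hi2 : Integrable ((Metric.closedBall (0 : Plane) t \ Metric.closedBall 0 s).indicator
      fun _ => 1 - θ) :=
    (integrable_indicator_iff (measurableSet_closedBall.diff measurableSet_closedBall)).2
      (integrableOn_const (measure_ne_top_of_subset Set.sdiff_subset
        measure_closedBall_lt_top.ne))
  have hi3 := (RadioSystem.integrable_damping (S := S) hr.le hmax).const_mul
    (∑ j ∈ C.cache i, C.alpha j)
  have hi4 := (RadioSystem.integrable_damping (S := S) hr.le ht).const_mul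
    (∑ j ∈ (C.cache i)ᶜ, C.alpha j)
  have hint : Integrable (fun y => 1 - shell C S i s t θ r y) :=
    ((hi1.add hi2).add (hi3.add hi4)).congr hae.symm
  have hval : ∫ y, (1 - shell C S i s t θ r y) =
      Real.pi * s ^ 2 + Real.pi * (t ^ 2 - s ^ 2) * (1 - θ) +
      ((∑ j ∈ C.cache i, C.alpha j) *
          (Real.pi * r ^ 2 * S.Z1 ((r / max t S.Rb) ^ S.β * S.Tbar)) +
        (∑ j ∈ (C.cache i)ᶜ, C.alpha j) *
          (Real.pi * r ^ 2 * S.Z1 ((r / t) ^ S.β * S.Tbar))) := by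
    rw [integral_congr_ae hae, integral_add (hi1.fun_add hi2) (hi3.fun_add hi4), integral_add hi1 hi2,
      integral_add hi3 hi4, integral_const_mul, integral_const_mul,
      RadioSystem.integral_damping hr hmax, RadioSystem.integral_damping hr ht,
      integral_indicator_const _ measurableSet_closedBall,
      integral_indicator_const _ (measurableSet_closedBall.diff measurableSet_closedBall),
      volume_real_closedBall_plane hs, volume_real_annulus_plane hs hst, smul_eq_mul, smul_eq_mul,
      mul_one]
  have : SigmaFinite (ENNReal.ofReal S.lam • (volume : Measure Plane)) :=
    inferInstanceAs (SigmaFinite (S.lam.toNNReal • (volume : Measure Plane)))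
  rw [h.poisson.integral_infProd (measurable_shell s t θ r) (h.shell_nonneg hr.le hθ0)
    (h.shell_le_one hr.le hθ1) (hint.smul_measure ENNReal.ofReal_ne_top), integral_smul_measure,
    hval, ENNReal.toReal_ofReal S.lam_pos.le, interferenceExponent, lam1_eq, h.lam2_eq, smul_eq_mul]
  congr 1
  ring

theorem integrable_infProd_shell (h : IsDownlinkModel C S μ X K H) {s t θ r : ℝ} (hr : 0 ≤ r)
    (hθ0 : 0 ≤ θ) : Integrable (fun ω => infProd fun n => shell C S i s t θ r (X n ω)) μ := by
  refine Integrable.of_bound (measurable_infProd fun n =>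
    (measurable_shell s t θ r).comp (h.poisson.measurable n)).aestronglyMeasurable 1
    (Eventually.of_forall fun ω => ?_)
  rw [Real.norm_of_nonneg (infProd_nonneg fun n => h.shell_nonneg hr hθ0 _)]
  exact infProd_le_one fun n => h.shell_nonneg hr hθ0 _

theorem relNoise_mono (S : RadioSystem) {r r' : ℝ} (hr : 0 ≤ r) (hrr' : r ≤ r') :
    relNoise S r ≤ relNoise S r' := by
  have := S.Tbar_pos
  have := S.P_pos
  have := S.noise_nonneg
  have := S.β_pos
  unfold relNoise
  gcongr

/-- Upper bound: replace the serving distance by `s` and ignore the interferers in the shell. -/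
theorem measureReal_success_Ioc_le (h : IsDownlinkModel C S μ X K H) {s t : ℝ} (hs : 0 < s)
    (hst : s ≤ t) :
    μ.real {ω | S.Tbar ≤ sinr C S X K H i ω ∧ s < servingDist X ω ∧ servingDist X ω ≤ t} ≤
      S.lam * Real.pi * (t ^ 2 - s ^ 2) * Real.exp (-(relNoise S s + S.lam * Real.pi * s ^ 2 +
        interferenceExponent C S i s t)) := by
  obtain ⟨hFi, hF⟩ := h.measureReal_success_Ioc i s t
  have hi1 := h.integrable_infProd_shell (i := i) (s := s) (t := t) hs.le zero_le_one
  have hi0 := h.integrable_infProd_shell (i := i) (s := s) (t := t) hs.le le_rfl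
  have hle := integral_mono_ae hFi ((hi1.sub hi0).const_mul (Real.exp (-relNoise S s))) ?_
  · rw [hF]
    refine hle.trans ?_
    simp only [Pi.sub_apply]
    rw [integral_const_mul, integral_sub hi1 hi0,
      h.integral_infProd_shell hs.le hst (hs.trans_le hst) zero_le_one le_rfl hs,
      h.integral_infProd_shell hs.le hst (hs.trans_le hst) le_rfl zero_le_one hs]
    set Φ := interferenceExponent C S i s t
    set u := S.lam * Real.pi * (t ^ 2 - s ^ 2) with hu
    have h1 : Real.exp (-(S.lam * Real.pi * (s ^ 2 + (1 - 1) * (t ^ 2 - s ^ 2)) + Φ)) =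
        Real.exp (-(S.lam * Real.pi * s ^ 2 + Φ)) := by ring_nf
    have h2 : Real.exp (-(S.lam * Real.pi * (s ^ 2 + (1 - 0) * (t ^ 2 - s ^ 2)) + Φ)) =
        Real.exp (-(S.lam * Real.pi * s ^ 2 + Φ)) * Real.exp (-u) := by
      rw [← Real.exp_add, hu]
      ring_nf
    have h3 : Real.exp (-(relNoise S s + S.lam * Real.pi * s ^ 2 + Φ)) =
        Real.exp (-relNoise S s) * Real.exp (-(S.lam * Real.pi * s ^ 2 + Φ)) := by
      rw [← Real.exp_add]
      ring_nf
    rw [h1, h2, h3]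
    have h4 : 1 - Real.exp (-u) ≤ u := by linarith [Real.add_one_le_exp (-u)]
    calc Real.exp (-relNoise S s) * (Real.exp (-(S.lam * Real.pi * s ^ 2 + Φ)) -
          Real.exp (-(S.lam * Real.pi * s ^ 2 + Φ)) * Real.exp (-u))
        = (1 - Real.exp (-u)) *
          (Real.exp (-relNoise S s) * Real.exp (-(S.lam * Real.pi * s ^ 2 + Φ))) := by ring
      _ ≤ _ := by gcongr
  · filter_upwards [h.ae_finite_ball] with ω hω
    have hle : ∀ m, servingDist X ω ≤ ‖X m ω‖ := fun m => nearest_spec hω m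
    have hn1 : ∀ n, 0 ≤ shell C S i s t 1 s (X n ω) := fun n =>
      h.shell_nonneg hs.le zero_le_one _
    have hn0 : ∀ n, 0 ≤ shell C S i s t 0 s (X n ω) := fun n => h.shell_nonneg hs.le le_rfl _
    simp only [Pi.sub_apply]
    split_ifs with hR
    · have hz : infProd (fun n => shell C S i s t 0 s (X n ω)) ≤ 0 := by
        refine (infProd_le_factor hn0 (fun n => h.shell_le_one hs.le zero_le_one _)
          (servingIndex X ω)).trans_eq ?_
        exact (if_neg (not_le.2 hR.1)).trans (if_pos hR.2)
      have hle1 : infProd (fun m => if m = servingIndex X ω then 1 else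
          survival C S i (servingDist X ω) (X m ω)) ≤
          infProd fun n => shell C S i s t 1 s (X n ω) := by
        refine infProd_mono (fun m => ?_) fun m => ?_
        · split_ifs
          exacts [zero_le_one, h.survival_nonneg (norm_nonneg _) _]
        · have hm : ¬‖X m ω‖ ≤ s := not_le.2 (hR.1.trans_le (hle m))
          by_cases hmt : ‖X m ω‖ ≤ t
          · rw [shell, if_neg hm, if_pos hmt]
            split_ifs
            exacts [le_rfl, h.survival_le_one (norm_nonneg _) _]
          · have hne : m ≠ servingIndex X ω := by
              rintro rfl
              exact hmt hR.2
            rw [shell, if_neg hm, if_neg hmt, if_neg hne]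
            exact h.survival_anti hs.le hR.1.le _
      refine mul_le_mul (Real.exp_le_exp.2 (neg_le_neg (relNoise_mono S hs.le hR.1.le)))
        (by linarith) (infProd_nonneg fun m => ?_) (Real.exp_pos _).le
      split_ifs
      exacts [zero_le_one, h.survival_nonneg (norm_nonneg _) _]
    · refine mul_nonneg (Real.exp_pos _).le (sub_nonneg.2 (infProd_mono hn0 fun n => ?_))
      unfold shell
      split_ifs
      exacts [le_rfl, zero_le_one, le_rfl]

/-- A lower bound, by products that the generating functional can evaluate, for the conditional
probability of a success with serving distance in the shell. If there are `k` points in the shell and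
none nearer, the two products differ by the factor `θ ^ k` in place of `0 ^ k`, and the combination
is positive for `k = 1` at most. -/
theorem shell_combination_le (h : IsDownlinkModel C S μ X K H) {s t θ : ℝ} (ht : 0 ≤ t)
    (hθ0 : 0 < θ) (hθ1 : θ ≤ 1) {ω : Ω} (hω : ∀ ρ : ℕ, {n | ‖X n ω‖ ≤ ρ}.Finite) :
    Real.exp (-relNoise S t) * ((infProd (fun n => shell C S i s t θ t (X n ω)) -
        infProd fun n => shell C S i s t 0 t (X n ω)) / θ - θ) ≤
      if s < servingDist X ω ∧ servingDist X ω ≤ t then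
      Real.exp (-relNoise S (servingDist X ω)) * infProd (fun m =>
        if m = servingIndex X ω then 1 else survival C S i (servingDist X ω) (X m ω)) else 0 := by
  have hle : ∀ m, servingDist X ω ≤ ‖X m ω‖ := fun m => nearest_spec hω m
  have hnθ : ∀ n, 0 ≤ shell C S i s t θ t (X n ω) := fun n => h.shell_nonneg ht hθ0.le _
  have hθ1' : ∀ n, shell C S i s t θ t (X n ω) ≤ 1 := fun n => h.shell_le_one ht hθ1 _
  have hn0 : ∀ n, 0 ≤ shell C S i s t 0 t (X n ω) := fun n => h.shell_nonneg ht le_rfl _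
  set n₀ := servingIndex X ω with hn₀
  set R := servingDist X ω with hRdef
  have hRn : R = ‖X n₀ ω‖ := rfl
  have hR0 : 0 ≤ R := norm_nonneg _
  set pθ := infProd fun n => shell C S i s t θ t (X n ω) with hpθ
  set p0 := infProd fun n => shell C S i s t 0 t (X n ω) with hp0
  have hp0n : 0 ≤ p0 := infProd_nonneg hn0
  set q : ℕ → ℝ := fun m => if m = n₀ then 1 else survival C S i R (X m ω) with hq
  have hq0 : ∀ m, 0 ≤ q m := fun m => by
    simp only [hq]
    split_ifs
    exacts [zero_le_one, h.survival_nonneg hR0 _]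
  have hq1 : ∀ m, q m ≤ 1 := fun m => by
    simp only [hq]
    split_ifs
    exacts [le_rfl, h.survival_le_one hR0 _]
  split_ifs with hR
  · have hkey : (pθ - p0) / θ - θ ≤ infProd q := by
      suffices pθ / θ - θ ≤ infProd q by
        have : (pθ - p0) / θ ≤ pθ / θ := by gcongr; linarith
        linarith
      have hfac : shell C S i s t θ t (X n₀ ω) = θ := by
        rw [shell, ← hRn, if_neg (not_le.2 hR.1), if_pos hR.2]
      by_cases hex : ∃ m, m ≠ n₀ ∧ ‖X m ω‖ ≤ t
      · -- two points in the shell contribute a factor `θ ^ 2`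
        obtain ⟨m, hm, hmt⟩ := hex
        have hfacm : shell C S i s t θ t (X m ω) = θ := by
          rw [shell, if_neg (not_le.2 (hR.1.trans_le (hle m))), if_pos hmt]
        have h1 : pθ ≤ θ * infProd fun k => if k = m then θ else 1 := by
          refine infProd_le_mul hθ0.le n₀ hnθ (fun k => ?_) (fun k => ?_) ?_ fun k hk => ?_
          · split_ifs
            exacts [hθ1, le_rfl]
          · split_ifs
            exacts [hθ0.le, zero_le_one]
          · rw [if_neg hm.symm, mul_one, hfac]
          · split_ifs with hkm
            exacts [(hkm ▸ hfacm).le, hθ1' k]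
        have h2 : (infProd fun k => if k = m then θ else 1) ≤ θ := by
          refine (infProd_le_factor (fun k => ?_) (fun k => ?_) m).trans_eq (if_pos rfl)
          · split_ifs
            exacts [hθ0.le, zero_le_one]
          · split_ifs
            exacts [hθ1, le_rfl]
        have h3 : pθ / θ ≤ θ := (div_le_iff₀ hθ0).2 (h1.trans (by gcongr))
        linarith [infProd_nonneg hq0]
      · push Not at hex
        have h1 : pθ ≤ θ * infProd q := by
          refine infProd_le_mul hθ0.le n₀ hnθ hq1 hq0 ?_ fun k hk => ?_
          · simp [hq, hfac]
          · simp only [hq, if_neg hk]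
            rw [shell, if_neg (not_le.2 (hR.1.trans_le (hle k))), if_neg (not_le.2 (hex k hk))]
            exact h.survival_anti hR0 hR.2 _
        have h3 : pθ / θ ≤ infProd q := (div_le_iff₀ hθ0).2 (by rwa [mul_comm] at h1)
        linarith
    calc Real.exp (-relNoise S t) * ((pθ - p0) / θ - θ)
        ≤ Real.exp (-relNoise S t) * infProd q := by gcongr
      _ ≤ Real.exp (-relNoise S R) * infProd q := by
        gcongr
        · exact infProd_nonneg hq0
        · exact relNoise_mono S hR0 hR.2
  · have hkey : pθ ≤ p0 := by
      by_cases hs : R ≤ s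
      · refine le_trans ((infProd_le_factor hnθ hθ1' n₀).trans_eq ?_) hp0n
        rw [shell, ← hRn, if_pos hs]
      · have ht' : t < R := not_le.1 fun h' => hR ⟨not_le.1 hs, h'⟩
        refine infProd_mono hnθ fun n => le_of_eq ?_
        rw [shell, shell, if_neg (not_le.2 (ht'.trans_le (hle n)))]
        rw [if_neg (not_le.2 (ht'.trans_le (hle n)))]
    have : (pθ - p0) / θ ≤ 0 := div_nonpos_of_nonpos_of_nonneg (by linarith) hθ0.le
    exact mul_nonpos_of_nonneg_of_nonpos (Real.exp_pos _).le (by linarith)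

/-- Lower bound: replace the serving distance by `t` and require a single point in the shell. -/
theorem le_measureReal_success_Ioc (h : IsDownlinkModel C S μ X K H) {s t : ℝ} (hs : 0 < s)
    (hst : s ≤ t) :
    S.lam * Real.pi * (t ^ 2 - s ^ 2) * Real.exp (-(relNoise S t + S.lam * Real.pi * t ^ 2 +
        interferenceExponent C S i t t)) ≤
      μ.real {ω | S.Tbar ≤ sinr C S X K H i ω ∧ s < servingDist X ω ∧ servingDist X ω ≤ t} := by
  obtain ⟨hFi, hF⟩ := h.measureReal_success_Ioc i s t
  have ht : 0 < t := hs.trans_le hst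
  set Φ := interferenceExponent C S i t t with hΦ
  set u := S.lam * Real.pi * (t ^ 2 - s ^ 2) with hu
  set e := Real.exp (-(S.lam * Real.pi * t ^ 2 + Φ)) with he
  set c := Real.exp (-relNoise S t) with hc
  rw [hF]
  -- for each `θ` the bound holds up to an error `θ`, because `exp (θ u) - 1 ≥ θ u`
  have hθ : ∀ θ : ℝ, 0 < θ → θ ≤ 1 → c * (u * e - θ) ≤ ∫ ω, (if s < servingDist X ω ∧
      servingDist X ω ≤ t then Real.exp (-relNoise S (servingDist X ω)) * infProd (fun m =>
        if m = servingIndex X ω then 1 else survival C S i (servingDist X ω) (X m ω)) else 0)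
        ∂μ := by
    intro θ hθ0 hθ1
    have hi1 := h.integrable_infProd_shell (i := i) (s := s) (t := t) ht.le hθ0.le
    have hi0 := h.integrable_infProd_shell (i := i) (s := s) (t := t) ht.le le_rfl
    have hi : Integrable (fun ω => c * ((infProd (fun n => shell C S i s t θ t (X n ω)) -
        infProd fun n => shell C S i s t 0 t (X n ω)) / θ - θ)) μ :=
      (((hi1.sub hi0).div_const θ).sub (integrable_const θ)).const_mul c
    have hle := integral_mono_ae hi hFi (by
      filter_upwards [h.ae_finite_ball] with ω hω
      exact h.shell_combination_le ht.le hθ0 hθ1 hω)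
    refine le_trans ?_ hle
    rw [integral_const_mul, integral_sub ((Integrable.sub' hi1 hi0).div_const θ) (integrable_const θ),
      integral_div, integral_sub hi1 hi0,
      h.integral_infProd_shell hs.le hst ht hθ0.le hθ1 ht,
      h.integral_infProd_shell hs.le hst ht le_rfl zero_le_one ht, integral_const,
      probReal_univ, one_smul]
    have h1 : Real.exp (-(S.lam * Real.pi * (s ^ 2 + (1 - θ) * (t ^ 2 - s ^ 2)) + Φ)) =
        e * Real.exp (θ * u) := by
      rw [he, ← Real.exp_add, hu]
      ring_nf
    have h2 : Real.exp (-(S.lam * Real.pi * (s ^ 2 + (1 - 0) * (t ^ 2 - s ^ 2)) + Φ)) = e := by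
      rw [he]
      ring_nf
    rw [h1, h2]
    have h3 : u * e ≤ (e * Real.exp (θ * u) - e) / θ := by
      rw [le_div_iff₀ hθ0]
      have h4 := Real.add_one_le_exp (θ * u)
      have h5 : 0 < e := Real.exp_pos _
      nlinarith
    gcongr
  have hlim : Tendsto (fun θ : ℝ => c * (u * e - θ)) (𝓝[>] 0) (𝓝 (c * (u * e - 0))) :=
    ((tendsto_id.const_sub (u * e)).const_mul c).mono_left nhdsWithin_le_nhds
  have hfin := le_of_tendsto hlim (by
    filter_upwards [Ioc_mem_nhdsGT (zero_lt_one (α := ℝ))] with θ hθ'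
    exact hθ θ hθ'.1 hθ'.2)
  refine le_trans (le_of_eq ?_) hfin
  rw [sub_zero, he, hc, mul_left_comm, ← Real.exp_add]
  ring_nf

/-- The serving distance has no atoms: a nearest point in a shell is in particular a point in the
shell. -/
theorem measureReal_success_Ioc_le_area (h : IsDownlinkModel C S μ X K H) {s t : ℝ} (hs : 0 ≤ s)
    (hst : s ≤ t) :
    μ.real {ω | S.Tbar ≤ sinr C S X K H i ω ∧ s < servingDist X ω ∧ servingDist X ω ≤ t} ≤
      S.lam * Real.pi * (t ^ 2 - s ^ 2) := by
  set A : Set Plane := Metric.closedBall 0 t \ Metric.closedBall 0 s with hA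
  have hAm : MeasurableSet A := measurableSet_closedBall.diff measurableSet_closedBall
  have hAfin : volume A ≠ ⊤ := measure_ne_top_of_subset Set.sdiff_subset
    measure_closedBall_lt_top.ne
  have hΛ : (ENNReal.ofReal S.lam • (volume : Measure Plane)) A ≠ ⊤ :=
    ENNReal.mul_ne_top ENNReal.ofReal_ne_top hAfin
  have hle : μ {ω | S.Tbar ≤ sinr C S X K H i ω ∧ s < servingDist X ω ∧ servingDist X ω ≤ t} ≤
      (ENNReal.ofReal S.lam • (volume : Measure Plane)) A := by
    rw [← h.poisson.sum_map_apply hAm hΛ, Measure.sum_apply _ hAm]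
    calc _ ≤ μ (⋃ n, X n ⁻¹' A) := by
          refine measure_mono fun ω hω => Set.mem_iUnion.2 ⟨servingIndex X ω, ?_⟩
          simp only [hA, Set.mem_preimage, Set.mem_sdiff, Metric.mem_closedBall, dist_zero_right,
            not_le]
          exact ⟨hω.2.2, hω.2.1⟩
      _ ≤ ∑' n, μ (X n ⁻¹' A) := measure_iUnion_le _
      _ = ∑' n, μ.map (X n) A :=
          tsum_congr fun n => (Measure.map_apply (h.poisson.measurable n) hAm).symm
  have := ENNReal.toReal_mono hΛ hle
  rw [Measure.smul_apply, smul_eq_mul, ENNReal.toReal_mul, ENNReal.toReal_ofReal S.lam_pos.le,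
    ← measureReal_def, ← measureReal_def, volume_real_annulus_plane hs hst] at this
  linarith

end IsDownlinkModel

/-! ### The density of the serving distance on success -/

section Density

variable {N M : ℕ} {C : CachingScheme N M} {S : RadioSystem} {i : Fin (N.choose M)}

theorem continuous_relNoise (S : RadioSystem) : Continuous (relNoise S) := by
  have := S.β_pos
  unfold relNoise
  exact (((Real.continuous_rpow_const this.le).mul_const _).mul_const _).mul_const _

theorem continuousAt_interferenceExponent {s : ℝ} (hs : 0 < s) :
    ContinuousAt (fun p : ℝ × ℝ => interferenceExponent C S i p.1 p.2) (s, s) := by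
  have hβ := S.β_pos
  have hT := S.Tbar_pos
  have hZ : ∀ f : ℝ × ℝ → ℝ, ContinuousAt f (s, s) → 0 < f (s, s) →
      ContinuousAt (fun p => S.Z1 ((p.1 / f p) ^ S.β * S.Tbar)) (s, s) := by
    intro f hf hf0
    have hq : ContinuousAt (fun p : ℝ × ℝ => (p.1 / f p) ^ S.β * S.Tbar) (s, s) :=
      ((continuousAt_fst.div hf hf0.ne').rpow_const (Or.inr hβ.le)).mul_const _
    have hpos : 0 < (s / f (s, s)) ^ S.β * S.Tbar := by positivity
    exact ContinuousAt.comp (g := S.Z1)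
      (S.continuousOn_Z1.continuousAt (Ici_mem_nhds hpos)) hq
  unfold interferenceExponent
  refine (continuousAt_const.mul (continuousAt_fst.pow 2)).mul
    ((continuousAt_const.mul (hZ (fun p => max p.2 S.Rb) ?_ ?_)).add
      (continuousAt_const.mul (hZ (fun p => p.2) continuousAt_snd hs)))
  · exact (continuous_snd.max continuous_const).continuousAt
  · exact lt_max_of_lt_left hs

/-- The density of the serving distance on the event of a success. -/
noncomputable def successDensity (C : CachingScheme N M) (S : RadioSystem) (i : Fin (N.choose M))
    (r : ℝ) : ℝ :=
  2 * Real.pi * S.lam * (r * Real.exp (-(relNoise S r + S.lam * Real.pi * r ^ 2 +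
    interferenceExponent C S i r r)))

theorem successDensity_eq_nearIntegrand {r : ℝ} (hr : 0 < r) (hrb : r ≤ S.Rb) :
    successDensity C S i r = 2 * Real.pi * S.lam * nearIntegrand C S i r := by
  rw [successDensity, nearIntegrand, interferenceExponent, max_eq_right hrb, div_self hr.ne',
    Real.one_rpow, one_mul, relNoise]
  ring_nf

theorem successDensity_eq_farIntegrand {r : ℝ} (hr : 0 < r) (hrb : S.Rb ≤ r) :
    successDensity C S i r = 2 * Real.pi * S.lam * farIntegrand S r := by
  have hlam : S.lam1 C i + S.lam2 C i = S.lam := by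
    rw [RadioSystem.lam1, RadioSystem.lam2]
    ring
  rw [successDensity, farIntegrand, interferenceExponent, max_eq_left hrb, div_self hr.ne',
    Real.one_rpow, one_mul, relNoise, ← add_mul, hlam]
  ring_nf

theorem continuous_farIntegrand (S : RadioSystem) : Continuous (farIntegrand S) := by
  have h := continuous_relNoise S
  unfold relNoise at h
  unfold farIntegrand
  fun_prop

theorem continuousOn_nearIntegrand (C : CachingScheme N M) (S : RadioSystem)
    (i : Fin (N.choose M)) : ContinuousOn (nearIntegrand C S i) (Set.Icc 0 S.Rb) := by
  have hβ := S.β_pos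
  have hT := S.Tbar_pos
  have h := (continuous_relNoise S).continuousOn (s := Set.Icc 0 S.Rb)
  have hZ : ContinuousOn (fun r => S.Z1 ((r / S.Rb) ^ S.β * S.Tbar)) (Set.Icc 0 S.Rb) := by
    refine S.continuousOn_Z1.comp (Continuous.continuousOn ?_) fun r hr => ?_
    · exact ((Real.continuous_rpow_const hβ.le).comp (continuous_id.div_const _)).mul_const _
    · have h1 := hr.1
      have h2 := S.Rb_nonneg
      exact Set.mem_Ici.2 (by positivity)
  unfold relNoise at h
  unfold nearIntegrand
  fun_prop

theorem farIntegrand_nonneg {r : ℝ} (hr : 0 ≤ r) : 0 ≤ farIntegrand S r :=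
  mul_nonneg hr (Real.exp_pos _).le

theorem sinr_nonneg {Ω : Type*} (C : CachingScheme N M) (S : RadioSystem) (X : ℕ → Ω → Plane)
    (K : ℕ → Ω → Fin N) (H : ℕ → Ω → ℂ) (i : Fin (N.choose M)) (ω : Ω) :
    0 ≤ sinr C S X K H i ω := by
  have hrx : ∀ n, 0 ≤ rxPower S X H n ω := fun n => by
    have := S.P_pos
    unfold rxPower
    positivity
  refine div_nonneg (hrx _) (add_nonneg (add_nonneg (tsum_nonneg fun n => ?_)
    (tsum_nonneg fun n => ?_)) S.noise_nonneg)
  · split_ifs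
    exacts [hrx n, le_rfl]
  · split_ifs
    exacts [hrx n, le_rfl]

end Density

namespace IsDownlinkModel

variable {Ω : Type*} [MeasurableSpace Ω] {N M : ℕ} {C : CachingScheme N M} {S : RadioSystem}
  {μ : Measure Ω} [IsProbabilityMeasure μ] {X : ℕ → Ω → Plane} {K : ℕ → Ω → Fin N}
  {H : ℕ → Ω → ℂ} {i : Fin (N.choose M)}

theorem measureReal_success_sub (h : IsDownlinkModel C S μ X K H) {s t : ℝ} (hst : s ≤ t) :
    μ.real {ω | S.Tbar ≤ sinr C S X K H i ω ∧ servingDist X ω ≤ t} -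
      μ.real {ω | S.Tbar ≤ sinr C S X K H i ω ∧ servingDist X ω ≤ s} =
      μ.real {ω | S.Tbar ≤ sinr C S X K H i ω ∧ s < servingDist X ω ∧ servingDist X ω ≤ t} := by
  have hm : MeasurableSet {ω | servingDist X ω ≤ s} :=
    measurableSet_le h.measurable_servingDist measurable_const
  rw [← measureReal_inter_add_sdiff (s := {ω | S.Tbar ≤ sinr C S X K H i ω ∧
    servingDist X ω ≤ t}) hm]
  have h1 : {ω | S.Tbar ≤ sinr C S X K H i ω ∧ servingDist X ω ≤ t} ∩
      {ω | servingDist X ω ≤ s} = {ω | S.Tbar ≤ sinr C S X K H i ω ∧ servingDist X ω ≤ s} := by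
    ext ω
    exact ⟨fun hω => ⟨hω.1.1, hω.2⟩, fun hω => ⟨⟨hω.1, hω.2.trans hst⟩, hω.2⟩⟩
  have h2 : {ω | S.Tbar ≤ sinr C S X K H i ω ∧ servingDist X ω ≤ t} \
      {ω | servingDist X ω ≤ s} =
      {ω | S.Tbar ≤ sinr C S X K H i ω ∧ s < servingDist X ω ∧ servingDist X ω ≤ t} := by
    ext ω
    exact ⟨fun hω => ⟨hω.1.1, not_le.1 hω.2, hω.1.2⟩,
      fun hω => ⟨⟨hω.1, hω.2.2⟩, not_le.2 hω.2.1⟩⟩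
  rw [h1, h2]
  ring

theorem continuousOn_measureReal_success (h : IsDownlinkModel C S μ X K H) :
    ContinuousOn (fun t => μ.real {ω | S.Tbar ≤ sinr C S X K H i ω ∧ servingDist X ω ≤ t})
      (Set.Ici 0) := by
  set g := fun t => μ.real {ω | S.Tbar ≤ sinr C S X K H i ω ∧ servingDist X ω ≤ t} with hg
  have hbound : ∀ s t, 0 ≤ s → s ≤ t → |g t - g s| ≤ S.lam * Real.pi * (t ^ 2 - s ^ 2) := by
    intro s t hs hst
    simp only [hg]
    rw [h.measureReal_success_sub hst, abs_of_nonneg measureReal_nonneg]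
    exact h.measureReal_success_Ioc_le_area hs hst
  have hc : 0 ≤ S.lam * Real.pi := mul_nonneg S.lam_pos.le Real.pi_pos.le
  have hbound' : ∀ s t, 0 ≤ s → 0 ≤ t → dist (g t) (g s) ≤ S.lam * Real.pi * |t ^ 2 - s ^ 2| := by
    intro s t hs ht
    rw [Real.dist_eq]
    rcases le_total s t with hst | hst
    · exact (hbound s t hs hst).trans (mul_le_mul_of_nonneg_left (le_abs_self _) hc)
    · rw [abs_sub_comm, abs_sub_comm (t ^ 2)]
      exact (hbound t s ht hst).trans (mul_le_mul_of_nonneg_left (le_abs_self _) hc)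
  intro s hs
  refine tendsto_iff_dist_tendsto_zero.2 (squeeze_zero' (g := fun t =>
    S.lam * Real.pi * |t ^ 2 - s ^ 2|) (Eventually.of_forall fun t => dist_nonneg) ?_ ?_)
  · filter_upwards [self_mem_nhdsWithin] with t ht using hbound' s t hs ht
  · have : Continuous fun t : ℝ => S.lam * Real.pi * |t ^ 2 - s ^ 2| := by fun_prop
    have h0 := this.tendsto s
    simp only [sub_self, abs_zero, mul_zero] at h0
    exact h0.mono_left nhdsWithin_le_nhds

/-- The bounds for the shell from `s` to `t` have the same quotient by `t - s` in the limit
`t → s`. -/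
theorem hasDerivWithinAt_measureReal_success (h : IsDownlinkModel C S μ X K H) {s : ℝ}
    (hs : 0 < s) :
    HasDerivWithinAt
      (fun t => μ.real {ω | S.Tbar ≤ sinr C S X K H i ω ∧ servingDist X ω ≤ t})
      (successDensity C S i s) (Set.Ioi s) s := by
  rw [hasDerivWithinAt_iff_tendsto_slope' (by simp)]
  have hΦ := continuousAt_interferenceExponent (C := C) (S := S) (i := i) hs
  have hν := (continuous_relNoise S).continuousAt (x := s)
  have hval : S.lam * Real.pi * (s + s) * Real.exp (-(relNoise S s + S.lam * Real.pi * s ^ 2 +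
      interferenceExponent C S i s s)) = successDensity C S i s := by
    rw [successDensity]
    ring
  have hupper : Tendsto (fun t => S.lam * Real.pi * (t + s) * Real.exp (-(relNoise S s +
      S.lam * Real.pi * s ^ 2 + interferenceExponent C S i s t))) (𝓝[>] s)
      (𝓝 (successDensity C S i s)) := by
    have hΦ' : ContinuousAt (fun t => interferenceExponent C S i s t) s :=
      ContinuousAt.comp (f := fun t : ℝ => (s, t)) (x := s) hΦ (by fun_prop)
    have : ContinuousAt (fun t => S.lam * Real.pi * (t + s) * Real.exp (-(relNoise S s +
      S.lam * Real.pi * s ^ 2 + interferenceExponent C S i s t))) s := by fun_prop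
    exact hval ▸ this.tendsto.mono_left nhdsWithin_le_nhds
  have hlower : Tendsto (fun t => S.lam * Real.pi * (t + s) * Real.exp (-(relNoise S t +
      S.lam * Real.pi * t ^ 2 + interferenceExponent C S i t t))) (𝓝[>] s)
      (𝓝 (successDensity C S i s)) := by
    have hΦ' : ContinuousAt (fun t => interferenceExponent C S i t t) s :=
      ContinuousAt.comp (f := fun t : ℝ => (t, t)) (x := s) hΦ (by fun_prop)
    have : ContinuousAt (fun t => S.lam * Real.pi * (t + s) * Real.exp (-(relNoise S t +
      S.lam * Real.pi * t ^ 2 + interferenceExponent C S i t t))) s := by fun_prop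
    exact hval ▸ this.tendsto.mono_left nhdsWithin_le_nhds
  refine tendsto_of_tendsto_of_tendsto_of_le_of_le' hlower hupper ?_ ?_
  · filter_upwards [self_mem_nhdsWithin] with t ht
    have hst : s < t := ht
    have hpos : 0 < t - s := sub_pos.2 hst
    rw [slope_def_field, h.measureReal_success_sub hst.le, le_div_iff₀ hpos]
    refine le_trans (le_of_eq ?_) (h.le_measureReal_success_Ioc hs hst.le)
    ring
  · filter_upwards [self_mem_nhdsWithin] with t ht
    have hst : s < t := ht
    have hpos : 0 < t - s := sub_pos.2 hst
    rw [slope_def_field, h.measureReal_success_sub hst.le, div_le_iff₀ hpos]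
    refine (h.measureReal_success_Ioc_le hs hst.le).trans (le_of_eq ?_)
    ring

theorem measureReal_success_zero (h : IsDownlinkModel C S μ X K H) :
    μ.real {ω | S.Tbar ≤ sinr C S X K H i ω ∧ servingDist X ω ≤ 0} = 0 := by
  refine (measureReal_eq_zero_iff (measure_ne_top _ _)).2 (measure_mono_null (fun ω hω => ?_)
    (ae_iff.1 h.ae_location_ne_zero))
  exact fun hX => hX (servingIndex X ω) (norm_le_zero_iff.1 hω.2)

theorem nearSuccess_eq (h : IsDownlinkModel C S μ X K H) (i : Fin (N.choose M)) :
    IntervalIntegrable (nearIntegrand C S i) volume 0 S.Rb ∧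
    nearSuccess μ C S X K H i =
      2 * Real.pi * S.lam * ∫ r in (0 : ℝ)..S.Rb, nearIntegrand C S i r := by
  have hint : IntervalIntegrable (nearIntegrand C S i) volume 0 S.Rb :=
    (continuousOn_nearIntegrand C S i).intervalIntegrable_of_Icc S.Rb_nonneg
  refine ⟨hint, ?_⟩
  have hftc := intervalIntegral.integral_eq_sub_of_hasDeriv_right_of_le S.Rb_nonneg
    (h.continuousOn_measureReal_success (i := i) |>.mono Set.Icc_subset_Ici_self)
    (f' := fun r => 2 * Real.pi * S.lam * nearIntegrand C S i r) (fun r hr => by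
      rw [← successDensity_eq_nearIntegrand hr.1 hr.2.le]
      exact h.hasDerivWithinAt_measureReal_success hr.1) (hint.const_mul _)
  rw [intervalIntegral.integral_const_mul, h.measureReal_success_zero, sub_zero] at hftc
  exact hftc.symm

theorem integral_farIntegrand (h : IsDownlinkModel C S μ X K H) (i : Fin (N.choose M)) {t : ℝ}
    (ht : S.Rb ≤ t) : 2 * Real.pi * S.lam * ∫ r in S.Rb..t, farIntegrand S r =
      μ.real {ω | S.Tbar ≤ sinr C S X K H i ω ∧ S.Rb < servingDist X ω ∧
        servingDist X ω ≤ t} := by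
  have hftc := intervalIntegral.integral_eq_sub_of_hasDeriv_right_of_le ht
    (h.continuousOn_measureReal_success (i := i) |>.mono fun r hr => S.Rb_nonneg.trans hr.1)
    (f' := fun r => 2 * Real.pi * S.lam * farIntegrand S r) (fun r hr => by
      have hr0 : 0 < r := S.Rb_nonneg.trans_lt hr.1
      rw [← successDensity_eq_farIntegrand (C := C) (i := i) hr0 hr.1.le]
      exact h.hasDerivWithinAt_measureReal_success hr0)
    (((continuous_farIntegrand S).const_mul _).intervalIntegrable _ _)
  rw [intervalIntegral.integral_const_mul, h.measureReal_success_sub ht] at hftc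
  exact hftc

theorem farSuccess_eq (h : IsDownlinkModel C S μ X K H) (i : Fin (N.choose M)) :
    IntegrableOn (farIntegrand S) (Set.Ioi S.Rb) ∧
    farSuccess μ C S X K H i = 2 * Real.pi * S.lam * ∫ r in Set.Ioi S.Rb, farIntegrand S r := by
  have hc : 0 < 2 * Real.pi * S.lam := by
    have := S.lam_pos
    positivity
  have hint : IntegrableOn (farIntegrand S) (Set.Ioi S.Rb) := by
    refine integrableOn_Ioi_of_intervalIntegral_norm_bounded (b := fun n : ℕ => (n : ℝ))
      (l := atTop) (1 / (2 * Real.pi * S.lam)) S.Rb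
      (fun n => (continuous_farIntegrand S).integrableOn_Ioc) tendsto_natCast_atTop_atTop ?_
    filter_upwards [eventually_ge_atTop ⌈S.Rb⌉₊] with n hn
    have hn' : S.Rb ≤ n := Nat.ceil_le.1 hn
    have hnorm : ∫ r in S.Rb..n, ‖farIntegrand S r‖ = ∫ r in S.Rb..n, farIntegrand S r := by
      refine intervalIntegral.integral_congr fun r hr => ?_
      rw [Set.uIcc_of_le hn'] at hr
      exact Real.norm_of_nonneg (farIntegrand_nonneg (S.Rb_nonneg.trans hr.1))
    rw [hnorm, le_div_iff₀' hc, h.integral_farIntegrand i hn']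
    exact measureReal_le_one
  refine ⟨hint, ?_⟩
  have hlim1 := (intervalIntegral_tendsto_integral_Ioi S.Rb hint
    (tendsto_natCast_atTop_atTop (R := ℝ))).const_mul (2 * Real.pi * S.lam)
  set A : ℕ → Set Ω := fun n => {ω | S.Tbar ≤ sinr C S X K H i ω ∧ S.Rb < servingDist X ω ∧
    servingDist X ω ≤ n} with hA
  have hmono : Monotone A := fun m n hmn ω hω =>
    ⟨hω.1, hω.2.1, hω.2.2.trans (by exact_mod_cast hmn)⟩
  have hU : ⋃ n, A n = {ω | S.Tbar ≤ sinr C S X K H i ω ∧ S.Rb < servingDist X ω} := by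
    ext ω
    simp only [hA, Set.mem_iUnion, Set.mem_ofPred_eq]
    exact ⟨fun ⟨n, hn⟩ => ⟨hn.1, hn.2.1⟩, fun hω => ⟨⌈servingDist X ω⌉₊, hω.1, hω.2, Nat.le_ceil _⟩⟩
  have hlim2 := (ENNReal.tendsto_toReal (measure_ne_top μ _)).comp
    (tendsto_measure_iUnion_atTop (μ := μ) hmono)
  rw [hU] at hlim2
  refine tendsto_nhds_unique (hlim2.congr' ?_) hlim1
  filter_upwards [eventually_ge_atTop ⌈S.Rb⌉₊] with n hn
  exact (h.integral_farIntegrand i (Nat.ceil_le.1 hn)).symm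

theorem packetLossRate_eq (h : IsDownlinkModel C S μ X K H) {l : Fin N} (hl : l ∉ C.cache i) :
    packetLossRate μ C S X K H i l =
      1 - nearSuccess μ C S X K H i - farSuccess μ C S X K H i := by
  have hm : MeasurableSet {ω | servingDist X ω ≤ S.Rb} :=
    measurableSet_le h.measurable_servingDist measurable_const
  have hset : {ω | l ∉ C.cache i ∧ S.τ * S.B * Real.logb 2 (1 + sinr C S X K H i ω) < S.T} =
      {ω | S.Tbar ≤ sinr C S X K H i ω}ᶜ := by
    ext ω
    have h0 := sinr_nonneg C S X K H i ω
    have hc : 0 < S.τ * S.B := mul_pos S.τ_pos S.B_pos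
    simp only [Set.mem_ofPred_eq, Set.mem_compl_iff, hl, not_false_eq_true, true_and, not_le]
    rw [← lt_div_iff₀' hc, Real.logb_lt_iff_lt_rpow one_lt_two (by linarith),
      RadioSystem.Tbar, lt_sub_iff_add_lt']
  have hsplit := measureReal_inter_add_sdiff (μ := μ) (s := {ω | S.Tbar ≤ sinr C S X K H i ω}) hm
  have hfar : {ω | S.Tbar ≤ sinr C S X K H i ω} \ {ω | servingDist X ω ≤ S.Rb} =
      {ω | S.Tbar ≤ sinr C S X K H i ω ∧ S.Rb < servingDist X ω} := by
    ext ω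
    simp
  rw [hfar] at hsplit
  rw [packetLossRate, hset, probReal_compl_eq_one_sub₀ (h.nullMeasurableSet_success i), ← hsplit,
    sub_add_eq_sub_sub]
  rfl

end IsDownlinkModel
end CacheNet

theorem theorem1 {Ω : Type*} [MeasurableSpace Ω] (μ : MeasureTheory.Measure Ω)
    [MeasureTheory.IsProbabilityMeasure μ] {N M : ℕ} (C : CacheNet.CachingScheme N M)
    (S : CacheNet.RadioSystem) (X : ℕ → Ω → CacheNet.Plane) (K : ℕ → Ω → Fin N) (H : ℕ → Ω → ℂ)
    (hmodel : CacheNet.IsDownlinkModel C S μ X K H)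
    (i : Fin (N.choose M)) (l : Fin N) (hl : l ∉ C.cache i) :
    CacheNet.packetLossRate μ C S X K H i l =
        1 - CacheNet.nearSuccess μ C S X K H i - CacheNet.farSuccess μ C S X K H i ∧
      IntervalIntegrable (CacheNet.nearIntegrand C S i) MeasureTheory.volume 0 S.Rb ∧
      CacheNet.nearSuccess μ C S X K H i =
        2 * Real.pi * S.lam * ∫ r in (0 : ℝ)..S.Rb, CacheNet.nearIntegrand C S i r ∧
      MeasureTheory.IntegrableOn (CacheNet.farIntegrand S) (Set.Ioi S.Rb) ∧
      CacheNet.farSuccess μ C S X K H i =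
        2 * Real.pi * S.lam * ∫ r in Set.Ioi S.Rb, CacheNet.farIntegrand S r := by
  obtain ⟨hnear, hnear'⟩ := hmodel.nearSuccess_eq i
  obtain ⟨hfar, hfar'⟩ := hmodel.farSuccess_eq i
  exact ⟨hmodel.packetLossRate_eq hl, hnear, hnear', hfar, hfar'⟩
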